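/- Let $0<\alpha<1$ and let $\lambda\in\Lambda^s_\alpha:=\{\lambda\in\mathbb{C}\setminus\{0\}:|\arg\lambda|>\frac{\alpha\pi}{2}\}$, where $-\pi<\arg\lambda\le\pi$. Let $A_\lambda\in\mathbb{C}^{d\times d}$ be the Jordan block with $\lambda$ on the diagonal, $1$ on the superdiagonal and $0$ elsewhere, and let $g:[0,\infty)\to\mathbb{C}^{d}$ be bounded and continuous (in particular, $g$ may take values in $\mathbb{R}^d$). Consider the system $$ {}^{C}\!D^{\alpha}_{0+}x(t)=A_\lambda x(t)+g(t),\qquad t>0, $$ where a solution is a continuous function $x:[0,\infty)\to\mathbb{C}^d$ (with arbitrary initial value $x(0)$) that satisfies the equation for every $t>0$, and where ${}^{C}\!D^{\alpha}_{0+}$ is the Caputo derivative, taken componentwise, $$ ({}^{C}\!D^{\alpha}_{0+}u)(t)=\frac{d}{dt}\,\frac{1}{\Gamma(1-\alpha)}\int_0^t (t-\tau)^{-\alpha}\bigl(u(\tau)-u(0)\bigr)\,d\tau , $$ which equals $\frac{1}{\Gamma(1-\alpha)}\int_0^t (t-\tau)^{-\alpha}u'(\tau)\,d\tau$ if $u$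 is continuously differentiable on $[0,\infty)$. Then every solution of the system is bounded on $[0,\infty)$. If, additionally, $\lim_{t\to\infty}\|g(t)\|=0$, then every solution of the system tends to $0$ as $t\to\infty$. -/

import Mathlib

open Set Filter Topology

noncomputable section

namespace FracJordan

/-- The stable sector: nonzero complex numbers `l` with `|arg l| > α π / 2`,
where `arg` takes values in `(-π, π]`. -/
def stableSector (α : ℝ) : Set ℂ :=
  {l : ℂ | l ≠ 0 ∧ α * Real.pi / 2 < |Complex.arg l|}

/-- `C_∞(ℝ_{≥0}; X)`: functions that are continuous and bounded on `[0, ∞)`. Functions on the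
half-line are represented by functions on `ℝ` whose values at negative arguments play no role. -/
def BddCont {X : Type*} [NormedAddCommGroup X] (f : ℝ → X) : Prop :=
  ContinuousOn f (Ici 0) ∧ ∃ M : ℝ, ∀ t : ℝ, 0 ≤ t → ‖f t‖ ≤ M

/-- `C_∞^0(ℝ_{≥0}; X)`: members of `C_∞(ℝ_{≥0}; X)` whose norm tends to `0` at infinity. -/
def BddContDecay {X : Type*} [NormedAddCommGroup X] (f : ℝ → X) : Prop :=
  BddCont f ∧ Tendsto (fun t => ‖f t‖) atTop (𝓝 0)

/-- The Riemann–Liouville integral of order `β > 0` with lower limit `a`: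
`(1 / Γ(β)) ∫_a^t (t - τ)^(β - 1) u(τ) dτ`. -/
def rlIntegral (a β : ℝ) (u : ℝ → ℂ) (t : ℝ) : ℂ :=
  ((1 / Real.Gamma β : ℝ) : ℂ) * ∫ τ in a..t, (((t - τ) ^ (β - 1) : ℝ) : ℂ) * u τ

/-- `u` has at `t` the Caputo derivative `v` of order `α ∈ (0, 1)` with lower limit `a`:
`I^(1-α) (u - u(a))` is differentiable at `t` with derivative `v`. This is the Riemann–Liouville
derivative of `u - u(a)`. It equals `I^(1-α) u'` when `u` is continuously differentiable, and it is
also meaningful for solutions of fractional equations, which usually are not differentiable at `a`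
(for a merely continuous forcing they need not be differentiable anywhere). -/
def HasCaputoDerivAt (a α : ℝ) (u : ℝ → ℂ) (v : ℂ) (t : ℝ) : Prop :=
  HasDerivAt (rlIntegral a (1 - α) (fun τ => u τ - u a)) v t

/-- The `d × d` Jordan block with `l` on the diagonal and `1` on the superdiagonal. -/
def jordanBlock (d : ℕ) (l : ℂ) : Matrix (Fin d) (Fin d) ℂ :=
  Matrix.of fun i j => if i = j then l else if (i : ℕ) + 1 = (j : ℕ) then 1 else 0

/-- `x` is a solution on `[0, ∞)` of the system `D^α x(t) = A x(t) + g(t)`, where `D^α` is the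
Caputo derivative with lower limit `0`, taken componentwise: `x` is continuous on `[0, ∞)` and the
equation holds for all `t > 0`. The initial value `x 0` is arbitrary. -/
def IsSolution {d : ℕ} (α : ℝ) (A : Matrix (Fin d) (Fin d) ℂ) (g x : ℝ → Fin d → ℂ) : Prop :=
  ContinuousOn x (Ici 0) ∧
    ∀ t : ℝ, 0 < t → ∀ i : Fin d,
      HasCaputoDerivAt 0 α (fun s => x s i) (A.mulVec (x t) i + g t i) t

end FracJordan

end

namespace FracJordan

open MeasureTheory Complex
open scoped Convolution FourierTransform

/-! A Jordan block is solved from the last row upwards: each row is a scalar equation with diagonal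
coefficient `l`, forced by its component of `g` plus the component below. So it suffices that a
scalar equation turns bounded forcing into bounded solutions, and vanishing forcing into vanishing
ones.

Put `v = u - u 0` and `f = h + l * u 0`. Integrating the scalar equation gives an Abel-type Volterra
equation, solved by `v = r * f`, where `r` has Laplace transform `1 / (p ^ α - l)`. Everything rests
on `r` being integrable on the half-line (`exists_resolventKernel`). Then `‖v‖` is at most the `L¹`
norm of `r` times `sup ‖f‖`. If `h → 0`, then `f → l * u 0`; since `∫ r = -1 / l` (the transform at
`p = 0`), `v → -u 0`, that is, `u → 0`.

For the kernel, the inverse Laplace integral is taken along two rays of argument `±θ`, with `π / 2 <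
θ < π` and `α * θ < |arg l|`; the sector condition is what makes such `θ` available. The correction
`1 / (l * (1 + s))` makes the symbol vanish at both `s = 0` and `s = ∞`, hence integrable in `w =
log s`, and this alone gives `r ∈ L¹`. The transform of `r` is computed by a Cauchy formula in the
strip `|Im w| ≤ θ` (`integral_resolventSymbol_cauchy`).

That `v` must equal `r * f` is shown on each `(0, T)` by Fourier uniqueness
(`ae_eq_resolvent_convolution`). Truncation makes any growth hypothesis on the solution unnecessary.
-/

/-! ### Estimates and contour shifts in horizontal strips -/

theorem norm_exp_sub_ge_of_abs_im_le {β : ℝ} {μ : ℂ} (hμ : μ ≠ 0) (hβ0 : 0 ≤ β)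
    (hβ : β < |arg μ|) :
    ∃ δ > 0, ∀ w : ℂ, |w.im| ≤ β → δ * (1 + Real.exp w.re) ≤ ‖exp w - μ‖ := by
  obtain ⟨y₀, hy₀, hmax⟩ := (isCompact_Icc (a := -β) (b := β)).exists_isMaxOn
    ⟨0, by simp [hβ0]⟩ (f := fun y => Real.cos (y - arg μ)) (by fun_prop)
  have hc : Real.cos (y₀ - arg μ) < 1 := by
    refine lt_of_le_of_ne (Real.cos_le_one _) fun h => ?_
    have h1 := neg_pi_lt_arg μ
    have h2 := arg_le_pi μ
    have h3 : |arg μ| ≤ Real.pi := abs_arg_le_pi μ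
    have := (Real.cos_eq_one_iff_of_lt_of_lt (x := y₀ - arg μ)
      (by linarith [hy₀.1]) (by linarith [hy₀.2])).1 h
    have h5 : |arg μ| ≤ β := by
      rw [show arg μ = y₀ by linarith]; exact abs_le.2 hy₀
    linarith
  set c := max (Real.cos (y₀ - arg μ)) 0 with hcdef
  have hc1 : c < 1 := max_lt hc one_pos
  have hc0 : 0 ≤ c := le_max_right _ _
  have hM : 0 < ‖μ‖ := norm_pos_iff.2 hμ
  -- With `X = exp w.re`, the law of cosines and `cos ≤ c` give `‖exp w - μ‖² ≥ (1 - c) / 2 * (X +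
  -- ‖μ‖)²`, with a spare `(1 + c) / 2 * (X - ‖μ‖)²`. The factor `min 1 ‖μ‖` replaces `X + ‖μ‖` by
  -- `1 + X`.
  refine ⟨√((1 - c) / 2) * min 1 ‖μ‖, by positivity, fun w hw => ?_⟩
  have hcos : Real.cos (w.im - arg μ) ≤ c := (hmax (abs_le.1 hw)).trans (le_max_left _ _)
  have hX := Real.exp_pos w.re
  have key : ‖exp w - μ‖ ^ 2 = Real.exp w.re ^ 2 + ‖μ‖ ^ 2
      - 2 * Real.exp w.re * ‖μ‖ * Real.cos (w.im - arg μ) := by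
    have e1 : μ.re = ‖μ‖ * Real.cos (arg μ) := by rw [norm_mul_cos_arg]
    have e2 : μ.im = ‖μ‖ * Real.sin (arg μ) := by rw [norm_mul_sin_arg]
    rw [← normSq_eq_norm_sq, normSq_apply, sub_re, sub_im, exp_re, exp_im, e1, e2, Real.cos_sub]
    have s1 := Real.sin_sq_add_cos_sq w.im
    have s2 := Real.sin_sq_add_cos_sq (arg μ)
    linear_combination Real.exp w.re ^ 2 * s1 + ‖μ‖ ^ 2 * s2
  refine le_of_sq_le_sq ?_ (norm_nonneg _)
  rw [key, mul_pow, mul_pow, Real.sq_sqrt (by linarith)]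
  have h1 : min 1 ‖μ‖ * (1 + Real.exp w.re) ≤ Real.exp w.re + ‖μ‖ := by
    have := min_le_left 1 ‖μ‖
    have := min_le_right 1 ‖μ‖
    nlinarith
  have h2 : (min 1 ‖μ‖ * (1 + Real.exp w.re)) ^ 2 ≤ (Real.exp w.re + ‖μ‖) ^ 2 :=
    pow_le_pow_left₀ (by positivity) h1 2
  have h3 : Real.exp w.re * ‖μ‖ * Real.cos (w.im - arg μ) ≤ Real.exp w.re * ‖μ‖ * c :=
    mul_le_mul_of_nonneg_left hcos (by positivity)
  have h4 : 0 ≤ (1 + c) * (Real.exp w.re - ‖μ‖) ^ 2 := by positivity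
  nlinarith [mul_le_mul_of_nonneg_left h2 (by linarith : 0 ≤ (1 - c) / 2)]

theorem integrable_exp_neg_mul_abs {c : ℝ} (hc : 0 < c) :
    Integrable fun x : ℝ => Real.exp (-c * |x|) := by
  rw [← integrableOn_univ, ← Iic_union_Ioi (a := (0 : ℝ))]
  refine IntegrableOn.union ?_ ?_
  · refine (integrableOn_exp_mul_Iic hc 0).congr_fun (fun x hx => ?_) measurableSet_Iic
    simp only [abs_of_nonpos (mem_Iic.1 hx)]; ring_nf
  · refine (exp_neg_integrableOn_Ioi 0 hc).congr_fun (fun x hx => ?_) measurableSet_Ioi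
    simp only [abs_of_pos (mem_Ioi.1 hx)]

/-- Shifting a horizontal line of integration through a strip. -/
theorem integral_line_eq_of_differentiableOn_strip {f : ℂ → ℂ} {θ C c R : ℝ} (hθ : 0 ≤ θ)
    (hc : 0 < c) (hf : DifferentiableOn ℂ f {w | |w.im| ≤ θ})
    (hdecay : ∀ w : ℂ, |w.im| ≤ θ → R ≤ |w.re| → ‖f w‖ ≤ C * Real.exp (-c * |w.re|))
    (h1 : Integrable fun x : ℝ => f (x + θ * I))
    (h2 : Integrable fun x : ℝ => f (x + (-θ : ℝ) * I)) :
    ∫ x : ℝ, f (x + θ * I) = ∫ x : ℝ, f (x + (-θ : ℝ) * I) := by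
  have lim : ∀ g : ℝ → ℂ, Integrable g →
      Tendsto (fun X : ℝ => ∫ x in (-X)..X, g x) atTop (𝓝 (∫ x, g x)) := fun g hg =>
    intervalIntegral_tendsto_integral hg tendsto_neg_atTop_atBot tendsto_id
  have side : ∀ s : ℝ, |s| = 1 →
      Tendsto (fun X : ℝ => ∫ y in (-θ)..θ, f ((s * X : ℝ) + y * I)) atTop (𝓝 0) := by
    intro s hs
    have hb : Tendsto (fun X : ℝ => C * Real.exp (-c * X) * |θ - -θ|) atTop (𝓝 0) := by
      have : Tendsto (fun X : ℝ => Real.exp (-c * X)) atTop (𝓝 0) := by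
        refine Real.tendsto_exp_atBot.comp ?_
        exact tendsto_id.const_mul_atTop_of_neg (by linarith)
      simpa using (this.const_mul C).mul_const _
    refine squeeze_zero_norm' ?_ hb
    filter_upwards [eventually_ge_atTop R, eventually_ge_atTop 0] with X hX hX0
    refine intervalIntegral.norm_integral_le_of_norm_le_const fun y hy => ?_
    rw [uIoc_of_le (by linarith)] at hy
    have habs : |s * X| = X := by rw [abs_mul, hs, one_mul, abs_of_nonneg hX0]
    have := hdecay ((s * X : ℝ) + y * I) (by simpa using abs_le.2 ⟨hy.1.le, hy.2⟩)
      (by simp only [add_re, ofReal_re, mul_re, I_re, I_im, ofReal_im]; simpa [habs] using hX)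
    simpa [habs, abs_mul, hs, abs_of_nonneg hX0] using this
  have rect : ∀ X : ℝ, 0 ≤ X → (∫ x in (-X)..X, f (x + (-θ : ℝ) * I)) -
      (∫ x in (-X)..X, f (x + θ * I)) + I * (∫ y in (-θ)..θ, f ((1 * X : ℝ) + y * I)) -
      I * (∫ y in (-θ)..θ, f ((-1 * X : ℝ) + y * I)) = 0 := by
    intro X hX
    have := integral_boundary_rect_eq_zero_of_differentiableOn f (⟨-X, -θ⟩ : ℂ) (⟨X, θ⟩ : ℂ)
      (hf.mono fun w hw => ?_)
    · simpa using this
    · have := hw.2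
      simp only [mem_preimage, uIcc_of_le (show -θ ≤ θ by linarith)] at this
      exact abs_le.2 this
  have hlim := (((lim _ h2).sub (lim _ h1)).add ((side 1 (by simp)).const_mul I)).sub
    ((side (-1) (by simp)).const_mul I)
  have hz := hlim.congr' (f₂ := fun _ => (0 : ℂ)) (by
    filter_upwards [eventually_ge_atTop 0] with X hX using rect X hX)
  have := tendsto_nhds_unique hz tendsto_const_nhds
  simp only [mul_zero, add_zero, sub_zero] at this
  exact (sub_eq_zero.1 this).symm

/-! ### The corrected symbol and its decay -/

/-- The symbol `1 / (s ^ α - l) + 1 / (l (1 + s))` in the logarithmic coordinate `s = exp w`. -/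
noncomputable def resolventSymbol (α : ℝ) (l w : ℂ) : ℂ :=
  1 / (exp (α * w) - l) + 1 / (l * (1 + exp w))

theorem exp_mul_ne_of_abs_im_le {α θ : ℝ} {l : ℂ} (hα0 : 0 < α) (hl : l ≠ 0) (hθ0 : 0 ≤ θ)
    (hθ : α * θ < |arg l|) {w : ℂ} (hw : |w.im| ≤ θ) : exp (α * w) ≠ l := by
  obtain ⟨δ, hδ, h⟩ := norm_exp_sub_ge_of_abs_im_le hl (by positivity) hθ
  intro he
  have := h (α * w) (by simpa [abs_mul, abs_of_pos hα0] using
    mul_le_mul_of_nonneg_left hw hα0.le)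
  rw [he, sub_self, norm_zero] at this
  have : 0 < δ * (1 + Real.exp (α * w : ℂ).re) := by positivity
  linarith

theorem one_add_exp_ne_zero {θ : ℝ} (hθ0 : 0 ≤ θ) (hθ : θ < Real.pi) {w : ℂ} (hw : |w.im| ≤ θ) :
    1 + exp w ≠ 0 := by
  have := exp_mul_ne_of_abs_im_le (α := 1) (l := -1) one_pos (by simp) hθ0
    (by simpa [abs_of_pos Real.pi_pos] using hθ) hw
  simp only [ofReal_one, one_mul] at this
  intro h
  exact this (by linear_combination h)

theorem differentiableAt_resolventSymbol {α θ : ℝ} {l : ℂ} (hα0 : 0 < α) (hl : l ≠ 0)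
    (hθ0 : 0 ≤ θ) (hθpi : θ < Real.pi) (hθ : α * θ < |arg l|) {w : ℂ} (hw : |w.im| ≤ θ) :
    DifferentiableAt ℂ (resolventSymbol α l) w := by
  have h1 : exp (α * w) - l ≠ 0 := sub_ne_zero.2 (exp_mul_ne_of_abs_im_le hα0 hl hθ0 hθ hw)
  have h2 : l * (1 + exp w) ≠ 0 := mul_ne_zero hl (one_add_exp_ne_zero hθ0 hθpi hw)
  unfold resolventSymbol
  fun_prop (disch := assumption)

theorem norm_one_add_exp_ge {θ : ℝ} (hθ0 : 0 ≤ θ) (hθpi : θ < Real.pi) :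
    ∃ δ > 0, ∀ w : ℂ, |w.im| ≤ θ → δ * (1 + Real.exp w.re) ≤ ‖1 + exp w‖ := by
  obtain ⟨δ, hδ, h⟩ := norm_exp_sub_ge_of_abs_im_le (μ := -1) (by simp) hθ0
    (by simpa [abs_of_pos Real.pi_pos] using hθpi)
  refine ⟨δ, hδ, fun w hw => ?_⟩
  simpa [add_comm] using h w hw

theorem norm_resolventSymbol_le {α θ : ℝ} {l : ℂ} (hα0 : 0 < α) (hα1 : α < 1) (hl : l ≠ 0)
    (hθ0 : 0 ≤ θ) (hθpi : θ < Real.pi) (hθ : α * θ < |arg l|) :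
    ∃ C, 0 ≤ C ∧ ∀ w : ℂ, |w.im| ≤ θ →
      ‖resolventSymbol α l w‖ ≤ C * Real.exp (-α * |w.re|) := by
  obtain ⟨δ, hδ, h⟩ := norm_exp_sub_ge_of_abs_im_le hl (by positivity) hθ
  obtain ⟨ε, hε, h'⟩ := norm_one_add_exp_ge hθ0 hθpi
  have hl' : 0 < ‖l‖ := norm_pos_iff.2 hl
  refine ⟨(‖l‖ + 1) / (‖l‖ * δ * ε), by positivity, fun w hw => ?_⟩
  have hwα : |(α * w : ℂ).im| ≤ α * θ := by
    simpa [abs_mul, abs_of_pos hα0] using mul_le_mul_of_nonneg_left hw hα0.le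
  have h1 : exp (α * w) - l ≠ 0 := sub_ne_zero.2 (exp_mul_ne_of_abs_im_le hα0 hl hθ0 hθ hw)
  have h2 : 1 + exp w ≠ 0 := one_add_exp_ne_zero hθ0 hθpi hw
  -- Over a common denominator the constant terms cancel. What is left is of order `exp (α * w.re)`
  -- at the left end and `exp (-α * w.re)` at the right end.
  have e : resolventSymbol α l w
      = (l * exp w + exp (α * w)) / (l * (exp (α * w) - l) * (1 + exp w)) := by
    unfold resolventSymbol; field_simp; ring
  have b1 := h _ hwα
  have b2 := h' w hw
  have hre : (α * w : ℂ).re = α * w.re := by simp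
  rw [hre] at b1
  have num : ‖l * exp w + exp (α * w)‖ ≤ ‖l‖ * Real.exp w.re + Real.exp (α * w.re) := by
    refine (norm_add_le _ _).trans ?_
    rw [norm_mul, norm_exp, norm_exp, hre]
  have den : ‖l‖ * (δ * (1 + Real.exp (α * w.re))) * (ε * (1 + Real.exp w.re))
      ≤ ‖l * (exp (α * w) - l) * (1 + exp w)‖ := by
    rw [norm_mul, norm_mul]; gcongr
  have main : ‖l‖ * Real.exp w.re + Real.exp (α * w.re) ≤
      (‖l‖ + 1) * (Real.exp (-α * |w.re|) * ((1 + Real.exp (α * w.re)) * (1 + Real.exp w.re))) := by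
    have hx := Real.exp_pos w.re
    have hax := Real.exp_pos (α * w.re)
    rcases le_total w.re 0 with hn | hp
    · rw [abs_of_nonpos hn, neg_mul_neg]
      have : Real.exp w.re ≤ Real.exp (α * w.re) := Real.exp_le_exp.2 (by nlinarith)
      have h3 : Real.exp (α * w.re) ≤
          Real.exp (α * w.re) * ((1 + Real.exp (α * w.re)) * (1 + Real.exp w.re)) :=
        le_mul_of_one_le_right hax.le (by nlinarith)
      nlinarith
    · rw [abs_of_nonneg hp]
      have : Real.exp (α * w.re) ≤ Real.exp w.re := Real.exp_le_exp.2 (by nlinarith)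
      have h3 : Real.exp w.re ≤ Real.exp (-α * w.re) *
          ((1 + Real.exp (α * w.re)) * (1 + Real.exp w.re)) := by
        have : Real.exp (-α * w.re) * Real.exp (α * w.re) = 1 := by
          rw [← Real.exp_add]; simp
        have hm := Real.exp_pos (-α * w.re)
        calc Real.exp w.re = Real.exp (-α * w.re) * Real.exp (α * w.re) * Real.exp w.re := by
              rw [this, one_mul]
          _ = Real.exp (-α * w.re) * (Real.exp (α * w.re) * Real.exp w.re) := by ring
          _ ≤ _ := by gcongr <;> linarith
      nlinarith
  rw [e, norm_div]
  calc _ ≤ (‖l‖ * Real.exp w.re + Real.exp (α * w.re)) /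
        (‖l‖ * (δ * (1 + Real.exp (α * w.re))) * (ε * (1 + Real.exp w.re))) := by gcongr
    _ ≤ _ := by
      rw [div_le_iff₀ (by positivity)]
      refine main.trans (le_of_eq ?_)
      field_simp

theorem integrable_resolventSymbol_line {α θ : ℝ} {l : ℂ} (hα0 : 0 < α) (hα1 : α < 1)
    (hl : l ≠ 0) (hθ0 : 0 ≤ θ) (hθpi : θ < Real.pi) (hθ : α * θ < |arg l|) {y : ℝ}
    (hy : |y| ≤ θ) : Integrable fun x : ℝ => resolventSymbol α l (x + y * I) := by
  obtain ⟨C, -, hC⟩ := norm_resolventSymbol_le hα0 hα1 hl hθ0 hθpi hθ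
  refine ((integrable_exp_neg_mul_abs hα0).const_mul C).mono' ?_ (Eventually.of_forall fun x => ?_)
  · refine Continuous.aestronglyMeasurable (continuous_iff_continuousAt.2 fun x => ?_)
    have := (differentiableAt_resolventSymbol hα0 hl hθ0 hθpi hθ
      (w := x + y * I) (by simpa using hy)).continuousAt
    exact ContinuousAt.comp (f := fun x : ℝ => (x + y * I : ℂ)) this (by fun_prop)
  · simpa using hC (x + y * I) (by simpa using hy)

/-! ### Kernels carried by a ray and their Laplace transforms -/

/-- Superposition of decaying exponentials along the ray of argument `y`, in the logarithmic
coordinate. -/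
noncomputable def rayKernel (q : ℝ → ℂ) (y t : ℝ) : ℂ :=
  ∫ x : ℝ, q x * exp (x + y * I) * exp (t * exp (x + y * I))

/-- Integrating the modulus over `t` yields `‖q x‖ * exp x / (-exp x * cos y)`. The Jacobian `exp x`
cancels, so integrability of `q` on the logarithmic line is enough. -/
theorem integrable_rayKernel_integrand {q : ℝ → ℂ} (hq : Integrable q) {y : ℝ}
    (hy : Real.cos y < 0) :
    Integrable (fun z : ℝ × ℝ => q z.1 * exp (z.1 + y * I) * exp (z.2 * exp (z.1 + y * I)))
      (volume.prod (volume.restrict (Ioi 0))) := by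
  have hnorm : ∀ x t : ℝ, ‖q x * exp (x + y * I) * exp (t * exp (x + y * I))‖
      = ‖q x‖ * Real.exp x * Real.exp (-(-(Real.exp x * Real.cos y)) * t) := by
    intro x t
    rw [norm_mul, norm_mul, norm_exp, norm_exp]
    simp [exp_re, mul_comm]
  have hneg : ∀ x : ℝ, 0 < -(Real.exp x * Real.cos y) := fun x => by
    have := mul_neg_of_pos_of_neg (Real.exp_pos x) hy; linarith
  rw [integrable_prod_iff]
  · refine ⟨Eventually.of_forall fun x => ?_, ?_⟩
    · refine Integrable.mono' (g := fun t => ‖q x‖ * Real.exp x *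
        Real.exp (-(-(Real.exp x * Real.cos y)) * t))
        ((exp_neg_integrableOn_Ioi 0 (hneg x)).const_mul _) ?_
        (Eventually.of_forall fun t => (hnorm x t).le)
      exact Continuous.aestronglyMeasurable (by dsimp only; fun_prop)
    · refine (hq.norm.mul_const (-Real.cos y)⁻¹).congr (Eventually.of_forall fun x => ?_)
      simp only [hnorm]
      rw [integral_const_mul, integral_exp_mul_Ioi (by have := hneg x; linarith)]
      have := (Real.exp_pos x).ne'
      have := hy.ne
      simp
      field_simp
  · refine AEStronglyMeasurable.mul (AEStronglyMeasurable.mul hq.1.comp_fst ?_) ?_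
    · exact Continuous.aestronglyMeasurable (by fun_prop)
    · exact Continuous.aestronglyMeasurable (by fun_prop)

theorem integrableOn_rayKernel {q : ℝ → ℂ} (hq : Integrable q) {y : ℝ} (hy : Real.cos y < 0) :
    IntegrableOn (rayKernel q y) (Ioi 0) :=
  (integrable_rayKernel_integrand hq hy).integral_prod_right

theorem laplace_rayKernel {q : ℝ → ℂ} (hq : Integrable q) {y : ℝ} (hy : Real.cos y < 0) {p : ℂ}
    (hp : 0 < p.re) :
    ∫ t in Ioi (0 : ℝ), exp (-p * t) * rayKernel q y t
      = ∫ x : ℝ, q x * (exp (x + y * I) / (p - exp (x + y * I))) := by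
  have hint : Integrable (fun z : ℝ × ℝ => exp (-p * z.2) *
      (q z.1 * exp (z.1 + y * I) * exp (z.2 * exp (z.1 + y * I))))
      (volume.prod (volume.restrict (Ioi 0))) := by
    have h0 := integrable_rayKernel_integrand hq hy
    refine h0.norm.mono' (AEStronglyMeasurable.mul
      (Continuous.aestronglyMeasurable (by fun_prop)) h0.1) ?_
    have : ∀ᵐ z : ℝ × ℝ ∂(volume.prod (volume.restrict (Ioi 0))), 0 < z.2 :=
      Measure.quasiMeasurePreserving_snd.ae (p := fun t : ℝ => 0 < t)
        (ae_restrict_mem measurableSet_Ioi)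
    filter_upwards [this] with z hz
    rw [norm_mul]
    refine mul_le_of_le_one_left (norm_nonneg _) ?_
    rw [norm_exp, Real.exp_le_one_iff]
    simp
    positivity
  have swap := integral_integral_swap
    (f := fun x t : ℝ => exp (-p * t) * (q x * exp (x + y * I) * exp (t * exp (x + y * I)))) hint
  simp only [rayKernel]
  simp_rw [← integral_const_mul]
  rw [← swap]
  congr 1 with x
  have hre : (exp (x + y * I) - p).re < 0 := by
    have := mul_neg_of_pos_of_neg (Real.exp_pos x) hy
    simp [exp_re]; linarith
  have e : ∀ t : ℝ, exp (-p * t) * (q x * exp (x + y * I) * exp (t * exp (x + y * I)))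
      = q x * exp (x + y * I) * exp ((exp (x + y * I) - p) * t) := by
    intro t
    rw [mul_left_comm, ← exp_add]; ring_nf
  simp_rw [e]
  rw [integral_const_mul, integral_exp_mul_complex_Ioi hre]
  have : exp (x + y * I) - p ≠ 0 := fun h => by rw [h] at hre; simp at hre
  have : p - exp (x + y * I) ≠ 0 := fun h => this (by linear_combination -h)
  simp
  field_simp
  ring

/-! ### The Cauchy formula in the strip -/

/-- The term `exp w / (p - exp w)` tends to `-1` at the right end and so is not integrable along a
line. Adding `exp w / (1 + exp w)` restores decay there and introduces no pole with `|Im w| < π`. -/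
theorem exp_div_sub_line_sum {p w : ℂ} (h1 : 1 + exp w ≠ 0) (h2 : p - exp w ≠ 0) :
    exp w / (1 + exp w) + exp w / (p - exp w)
      = (p + 1) / (1 + exp w) * (exp w / (p - exp w)) := by
  field_simp
  ring

theorem exp_div_one_add_exp_sq_le (x : ℝ) :
    Real.exp x / (1 + Real.exp x) ^ 2 ≤ Real.exp (-1 * |x|) := by
  have hx := Real.exp_pos x
  rw [div_le_iff₀ (by positivity)]
  rcases le_total x 0 with h | h
  · rw [abs_of_nonpos h, neg_one_mul, neg_neg]
    exact le_mul_of_one_le_right hx.le (by nlinarith)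
  · rw [abs_of_nonneg h, neg_one_mul, Real.exp_neg]
    field_simp
    nlinarith

theorem sub_exp_re_ge (p : ℂ) (y x : ℝ) :
    min p.re (-Real.cos y) * (1 + Real.exp x) ≤ (p - exp (x + y * I)).re := by
  have e : (p - exp (x + y * I)).re = p.re + Real.exp x * (-Real.cos y) := by
    simp [exp_re]; ring
  rw [e]
  have := min_le_left p.re (-Real.cos y)
  have := mul_le_mul_of_nonneg_left (min_le_right p.re (-Real.cos y)) (Real.exp_pos x).le
  linarith

theorem integrable_log_deriv_line {p : ℂ} (hp : 0 < p.re) {y : ℝ} (hy : Real.cos y < 0)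
    (hypi : |y| < Real.pi) :
    Integrable fun x : ℝ => exp (x + y * I) / (1 + exp (x + y * I))
      + exp (x + y * I) / (p - exp (x + y * I)) := by
  obtain ⟨ε, hε, h⟩ := norm_one_add_exp_ge (abs_nonneg y) hypi
  set m := min p.re (-Real.cos y) with hm
  have hm0 : 0 < m := lt_min hp (by linarith)
  have h1 : ∀ x : ℝ, 1 + exp (x + y * I) ≠ 0 := fun x =>
    one_add_exp_ne_zero (abs_nonneg y) hypi (by simp)
  have hre : ∀ x : ℝ, m * (1 + Real.exp x) ≤ ‖p - exp (x + y * I)‖ := fun x =>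
    (sub_exp_re_ge p y x).trans (re_le_norm _)
  have h2 : ∀ x : ℝ, p - exp (x + y * I) ≠ 0 := fun x hx => by
    have := hre x
    rw [hx, norm_zero] at this
    have : 0 < m * (1 + Real.exp x) := by positivity
    linarith
  refine ((integrable_exp_neg_mul_abs one_pos).const_mul (‖p + 1‖ / (ε * m))).mono' ?_
    (Eventually.of_forall fun x => ?_)
  · exact Continuous.aestronglyMeasurable (by fun_prop (disch := intro x; first | exact h1 x | exact h2 x))
  · rw [exp_div_sub_line_sum (h1 x) (h2 x), norm_mul, norm_div, norm_div, norm_exp]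
    have b1 : ε * (1 + Real.exp x) ≤ ‖1 + exp (x + y * I)‖ := by
      simpa using h (x + y * I) (by simp)
    have b2 := hre x
    have hx := Real.exp_pos x
    calc _ ≤ ‖p + 1‖ / (ε * (1 + Real.exp x)) * (Real.exp x / (m * (1 + Real.exp x))) := by
          have e : ((x : ℂ) + y * I).re = x := by simp
          rw [e]; gcongr
      _ = ‖p + 1‖ / (ε * m) * (Real.exp x / (1 + Real.exp x) ^ 2) := by field_simp
      _ ≤ _ := by gcongr; exact exp_div_one_add_exp_sq_le x

/-- A primitive is `log (1 + exp w) - log (p - exp w)`. No branch cut is met along the line: the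
first argument has nonzero imaginary part and the second has positive real part. -/
theorem integral_log_deriv_line {p : ℂ} (hp : 0 < p.re) {y : ℝ} (hy : Real.cos y < 0)
    (hypi : |y| < Real.pi) :
    ∫ x : ℝ, (exp (x + y * I) / (1 + exp (x + y * I)) + exp (x + y * I) / (p - exp (x + y * I)))
      = log (exp (y * I)) - log (-exp (y * I)) + log p := by
  have hsin : Real.sin y ≠ 0 := by
    have hy0 : y ≠ 0 := by rintro rfl; simp at hy; linarith
    intro h
    exact hy0 (Real.sin_eq_zero_iff_of_lt_of_lt (abs_lt.1 hypi).1 (abs_lt.1 hypi).2 |>.1 h)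
  have hs1 : ∀ x : ℝ, 1 + exp (x + y * I) ∈ slitPlane := fun x => by
    refine Or.inr ?_
    simp [exp_im, hsin]
  have hs2 : ∀ x : ℝ, p - exp (x + y * I) ∈ slitPlane := fun x => by
    refine Or.inl ?_
    have := mul_neg_of_pos_of_neg (Real.exp_pos x) hy
    simp [exp_re]; linarith
  have hω1 : exp (y * I) ∈ slitPlane := Or.inr (by simpa [exp_im] using hsin)
  have hω2 : -exp (y * I) ∈ slitPlane := Or.inl (by simpa [exp_re] using hy)
  have hd : ∀ x : ℝ, HasDerivAt (fun x : ℝ => exp (x + y * I)) (exp (x + y * I)) x := fun x => by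
    simpa using ((hasDerivAt_id x).ofReal_comp.add_const (y * I)).cexp
  have hbot : Tendsto (fun x : ℝ => exp (x + y * I)) atBot (𝓝 0) := by
    rw [tendsto_zero_iff_norm_tendsto_zero]
    simpa [norm_exp] using Real.tendsto_exp_atBot
  have hE : ∀ x : ℝ, exp (x + y * I) = (Real.exp x : ℝ) * exp (y * I) := fun x => by
    rw [exp_add, ofReal_exp]
  have htop : Tendsto (fun x : ℝ => (Real.exp (-x) : ℂ)) atTop (𝓝 0) := by
    rw [← ofReal_zero]
    exact (continuous_ofReal.tendsto _).comp Real.tendsto_exp_neg_atTop_nhds_zero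
  have key := integral_of_hasDerivAt_of_tendsto
    (f := fun x : ℝ => log (1 + exp (x + y * I)) - log (p - exp (x + y * I)))
    (f' := fun x : ℝ => exp (x + y * I) / (1 + exp (x + y * I))
      + exp (x + y * I) / (p - exp (x + y * I)))
    (m := log 1 - log p) (n := log (exp (y * I)) - log (-exp (y * I))) (fun x => ?_)
    (integrable_log_deriv_line hp hy hypi) ?_ ?_
  · rw [key]; simp
  · have := (((hd x).const_add 1).clog_real (hs1 x)).sub (((hd x).const_sub p).clog_real (hs2 x))
    rw [neg_div, sub_neg_eq_add] at this
    exact this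
  · have a1 : Tendsto (fun x : ℝ => 1 + exp (x + y * I)) atBot (𝓝 1) := by
      simpa using hbot.const_add 1
    have a2 : Tendsto (fun x : ℝ => p - exp (x + y * I)) atBot (𝓝 p) := by
      simpa using hbot.const_sub p
    exact (a1.clog (by simp)).sub (a2.clog (Or.inl hp))
  · have a1 : Tendsto (fun x : ℝ => (Real.exp (-x) : ℂ) + exp (y * I)) atTop
        (𝓝 (exp (y * I))) := by simpa using htop.add_const (exp (y * I))
    have a2 : Tendsto (fun x : ℝ => p * (Real.exp (-x) : ℂ) - exp (y * I)) atTop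
        (𝓝 (-exp (y * I))) := by simpa using (htop.const_mul p).sub_const (exp (y * I))
    -- Each logarithm diverges like `x`; pulling the positive factor `exp x` out of both arguments
    -- makes the divergent parts cancel.
    refine ((a1.clog hω1).sub (a2.clog hω2)).congr fun x => ?_
    have hne : (Real.exp x : ℂ) * (Real.exp (-x) : ℂ) = 1 := by
      rw [← ofReal_mul, ← Real.exp_add]; simp
    have e1 : 1 + exp (x + y * I) = (Real.exp x : ℝ) * ((Real.exp (-x) : ℂ) + exp (y * I)) := by
      rw [hE, mul_add, hne]
    have e2 : p - exp (x + y * I)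
        = (Real.exp x : ℝ) * (p * (Real.exp (-x) : ℂ) - exp (y * I)) := by
      rw [hE, mul_sub, mul_left_comm, hne, mul_one]
    have n1 : (Real.exp (-x) : ℂ) + exp (y * I) ≠ 0 := fun h =>
      slitPlane_ne_zero (hs1 x) (by rw [e1, h, mul_zero])
    have n2 : p * (Real.exp (-x) : ℂ) - exp (y * I) ≠ 0 := fun h =>
      slitPlane_ne_zero (hs2 x) (by rw [e2, h, mul_zero])
    rw [e1, e2, log_ofReal_mul (Real.exp_pos x) n1, log_ofReal_mul (Real.exp_pos x) n2]
    ring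

theorem integral_log_deriv_line_sub {p : ℂ} (hp : 0 < p.re) {θ : ℝ} (hθ1 : Real.pi / 2 < θ)
    (hθ2 : θ < Real.pi) :
    (∫ x : ℝ, (exp (x + θ * I) / (1 + exp (x + θ * I)) + exp (x + θ * I) / (p - exp (x + θ * I))))
      - (∫ x : ℝ, (exp (x + (-θ : ℝ) * I) / (1 + exp (x + (-θ : ℝ) * I))
        + exp (x + (-θ : ℝ) * I) / (p - exp (x + (-θ : ℝ) * I)))) = 2 * Real.pi * I := by
  have hpi := Real.pi_pos
  have hcos : Real.cos θ < 0 := Real.cos_neg_of_pi_div_two_lt_of_lt hθ1 (by linarith)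
  have habs : |θ| < Real.pi := by rwa [abs_of_pos (by linarith)]
  rw [integral_log_deriv_line hp hcos habs,
    integral_log_deriv_line hp (by rwa [Real.cos_neg]) (by rwa [abs_neg])]
  have l1 : log (exp (θ * I)) = θ * I := log_exp (by simp; linarith) (by simp; linarith)
  have l2 : log (exp ((-θ : ℝ) * I)) = (-θ : ℝ) * I :=
    log_exp (by simp; linarith) (by simp; linarith)
  have e1 : -exp (θ * I) = exp ((θ - Real.pi : ℝ) * I) := by
    rw [ofReal_sub, sub_mul, exp_sub, exp_pi_mul_I, div_neg, div_one]
  have e2 : -exp ((-θ : ℝ) * I) = exp ((-θ + Real.pi : ℝ) * I) := by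
    rw [ofReal_add, add_mul, exp_add, exp_pi_mul_I, mul_neg, mul_one]
  have l3 : log (exp ((θ - Real.pi : ℝ) * I)) = (θ - Real.pi : ℝ) * I :=
    log_exp (by simp; linarith) (by simp; linarith)
  have l4 : log (exp ((-θ + Real.pi : ℝ) * I)) = (-θ + Real.pi : ℝ) * I :=
    log_exp (by simp; linarith) (by simp; linarith)
  rw [e1, e2, l1, l2, l3, l4]
  push_cast
  ring

theorem norm_exp_div_sub_exp_le {p : ℂ} (hp : p ≠ 0) :
    ∃ R K : ℝ, 0 ≤ K ∧ ∀ w : ℂ, R ≤ |w.re| → p - exp w ≠ 0 ∧ ‖exp w / (p - exp w)‖ ≤ K ∧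
      ‖exp w / (p - exp w)‖ ≤ K * Real.exp w.re := by
  have hp0 : 0 < ‖p‖ := norm_pos_iff.2 hp
  -- This `R` separates `exp w.re` from `‖p‖` by a factor of at least two. Later the constant bound
  -- serves the right end and the bound by `exp w.re` the left end.
  refine ⟨max (Real.log (2 * ‖p‖)) (-Real.log (‖p‖ / 2)), max (max 2 (2 / ‖p‖)) 0,
    le_max_right _ _, fun w hw => ?_⟩
  set K := max (max 2 (2 / ‖p‖)) 0
  have hK1 : 2 ≤ K := (le_max_left _ _).trans (le_max_left _ _)
  have hK2 : 2 / ‖p‖ ≤ K := (le_max_right _ _).trans (le_max_left _ _)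
  have hX := Real.exp_pos w.re
  have hr : |‖p‖ - Real.exp w.re| ≤ ‖p - exp w‖ := by
    rw [← norm_exp]; exact abs_norm_sub_norm_le _ _
  have hr1 := (abs_le.1 (hr.trans le_rfl)).1
  have hr2 := (abs_le.1 (hr.trans le_rfl)).2
  rw [norm_div, norm_exp]
  rcases le_total 0 w.re with h | h
  · rw [abs_of_nonneg h] at hw
    have h1 : 2 * ‖p‖ ≤ Real.exp w.re := by
      rw [← Real.log_le_iff_le_exp (by positivity)]; exact (le_max_left _ _).trans hw
    have h2 : Real.exp w.re / 2 ≤ ‖p - exp w‖ := by linarith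
    have h3 : Real.exp w.re / ‖p - exp w‖ ≤ 2 := by
      rw [div_le_iff₀ (by linarith)]; linarith
    have h4 : 1 ≤ Real.exp w.re := Real.one_le_exp h
    exact ⟨norm_pos_iff.1 (by linarith), h3.trans hK1, h3.trans (by nlinarith)⟩
  · rw [abs_of_nonpos h] at hw
    have h1 : Real.exp w.re ≤ ‖p‖ / 2 := by
      rw [← Real.le_log_iff_exp_le (by positivity)]
      linarith [(le_max_right (Real.log (2 * ‖p‖)) (-Real.log (‖p‖ / 2))).trans hw]
    have h2 : ‖p‖ / 2 ≤ ‖p - exp w‖ := by linarith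
    have h3 : Real.exp w.re / ‖p - exp w‖ ≤ K * Real.exp w.re := by
      calc _ ≤ Real.exp w.re / (‖p‖ / 2) := by gcongr
        _ = 2 / ‖p‖ * Real.exp w.re := by field_simp
        _ ≤ _ := by gcongr
    have h4 : Real.exp w.re ≤ 1 := Real.exp_le_one_iff.2 h
    exact ⟨norm_pos_iff.1 (by linarith), h3.trans (by nlinarith), h3⟩

theorem exp_ne_of_strip {p : ℂ} {w : ℂ} (hw : |w.im| < Real.pi) (hne : w ≠ log p) :
    exp w ≠ p := fun h => hne <| by
  rw [← h, log_exp (abs_lt.1 hw).1 (abs_lt.1 hw).2.le]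

/-- In the strip `exp w = p` only at `w = log p`, where the zero of `exp w - p` is simple, so the
denominator never vanishes. When `P (log p) = 0`, this is `exp w * P w / (p - exp w)` with its
singularity removed. -/
theorem differentiableOn_strip_of_simple_pole {P : ℂ → ℂ} {θ : ℝ} (hθ1 : Real.pi / 2 < θ)
    (hθ2 : θ < Real.pi) {p : ℂ} (hp : 0 < p.re) (hP : DifferentiableOn ℂ P {w | |w.im| ≤ θ}) :
    DifferentiableOn ℂ (fun w => -exp w * dslope P (log p) w / dslope exp (log p) w)
      {w | |w.im| ≤ θ} := by
  have hp0 : p ≠ 0 := by rintro rfl; simp at hp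
  have hmem : {w : ℂ | |w.im| ≤ θ} ∈ 𝓝 (log p) := by
    have : |(log p).im| < θ := by
      rw [log_im]
      exact (abs_arg_lt_pi_div_two_iff.2 (Or.inl hp)).trans hθ1
    exact Filter.mem_of_superset
      ((isOpen_lt continuous_im.abs continuous_const).mem_nhds this)
      fun w (hw : |w.im| < θ) => hw.le
  refine DifferentiableOn.div (DifferentiableOn.mul (by fun_prop)
    ((differentiableOn_dslope hmem).2 hP))
    ((differentiableOn_dslope hmem).2 differentiable_exp.differentiableOn) fun w hw => ?_
  rcases eq_or_ne w (log p) with rfl | hne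
  · rw [dslope_same, Complex.deriv_exp]; exact exp_ne_zero _
  · rw [dslope_of_ne _ hne, slope_def_field, exp_log hp0]
    exact div_ne_zero (sub_ne_zero.2 (exp_ne_of_strip (lt_of_le_of_lt hw hθ2) hne))
      (sub_ne_zero.2 hne)

/-- The pole at `log p` is removed by subtracting `Q (log p)` times the explicit integrand `B`. The
remainder `D` is holomorphic in the strip and has equal integrals over the two edges; the integrals
of `B` differ by `2πi`. -/
theorem integral_resolventSymbol_cauchy {α θ : ℝ} {l p : ℂ} (hα0 : 0 < α) (hα1 : α < 1)
    (hl : l ≠ 0) (hθ1 : Real.pi / 2 < θ) (hθ2 : θ < Real.pi) (hθ : α * θ < |arg l|)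
    (hp : 0 < p.re) :
    (∫ x : ℝ, resolventSymbol α l (x + θ * I) * (exp (x + θ * I) / (p - exp (x + θ * I))))
      - (∫ x : ℝ, resolventSymbol α l (x + (-θ : ℝ) * I)
        * (exp (x + (-θ : ℝ) * I) / (p - exp (x + (-θ : ℝ) * I))))
      = 2 * Real.pi * I * resolventSymbol α l (log p) := by
  have hpi := Real.pi_pos
  have hθ0 : 0 < θ := by linarith
  have hp0 : p ≠ 0 := by rintro rfl; simp at hp
  have hcos : Real.cos θ < 0 := Real.cos_neg_of_pi_div_two_lt_of_lt hθ1 (by linarith)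
  set Q := resolventSymbol α l with hQ
  set w₀ := log p with hw₀
  let B : ℂ → ℂ := fun w => exp w / (1 + exp w) + exp w / (p - exp w)
  let N : ℂ → ℂ := fun w => Q w * (exp w / (p - exp w))
  let P : ℂ → ℂ := fun w => Q w - Q w₀ * ((p + 1) / (1 + exp w))
  let D : ℂ → ℂ := fun w => -exp w * dslope P w₀ w / dslope exp w₀ w
  have hw₀im : |w₀.im| < Real.pi / 2 := by
    rw [hw₀, log_im]; exact abs_arg_lt_pi_div_two_iff.2 (Or.inl hp)
  have hone : ∀ w : ℂ, |w.im| ≤ θ → 1 + exp w ≠ 0 := fun w hw =>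
    one_add_exp_ne_zero hθ0.le hθ2 hw
  have hPd : DifferentiableOn ℂ P {w | |w.im| ≤ θ} := fun w hw => by
    refine DifferentiableAt.differentiableWithinAt ?_
    have h1 := differentiableAt_resolventSymbol hα0 hl hθ0.le hθ2 hθ hw
    have h2 := hone w hw
    simp only [P]
    exact h1.sub (DifferentiableAt.const_mul (by fun_prop (disch := assumption)) _)
  have hP0 : P w₀ = 0 := by
    have : 1 + p ≠ 0 := fun h => by
      have := congrArg re h; simp at this; linarith
    simp only [P, hw₀, exp_log hp0]
    rw [add_comm p 1, div_self this]; ring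
  have hD : ∀ w : ℂ, |w.im| ≤ θ → w ≠ w₀ → D w = N w - Q w₀ * B w := by
    intro w hw hne
    have h1 := hone w hw
    have h2 : p - exp w ≠ 0 :=
      sub_ne_zero.2 (exp_ne_of_strip (lt_of_le_of_lt hw hθ2) hne).symm
    have h3 : w - w₀ ≠ 0 := sub_ne_zero.2 hne
    have h4 : exp w - p ≠ 0 := fun h => h2 (by linear_combination -h)
    simp only [D, N, B]
    rw [exp_div_sub_line_sum h1 h2, dslope_of_ne _ hne, dslope_of_ne _ hne, slope_def_field,
      slope_def_field, hP0, hw₀, exp_log hp0, ← hw₀, sub_zero]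
    have : P w = Q w - Q w₀ * ((p + 1) / (1 + exp w)) := rfl
    rw [this]
    field_simp
    ring
  obtain ⟨C, hC0, hC⟩ := norm_resolventSymbol_le hα0 hα1 hl hθ0.le hθ2 hθ
  obtain ⟨ε, hε, hε1⟩ := norm_one_add_exp_ge hθ0.le hθ2
  obtain ⟨R, K, hK, hR⟩ := norm_exp_div_sub_exp_le hp0
  have hdecay : ∀ w : ℂ, |w.im| ≤ θ → max R (|w₀.re| + 1) ≤ |w.re| →
      ‖D w‖ ≤ (C * K + ‖Q w₀‖ * (‖p + 1‖ / ε * K)) * Real.exp (-α * |w.re|) := by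
    intro w hw hwR
    obtain ⟨h2, r1, r2⟩ := hR w ((le_max_left _ _).trans hwR)
    have hne : w ≠ w₀ := by
      intro h
      rw [h] at hwR
      linarith [(le_max_right R (|w₀.re| + 1)).trans hwR]
    rw [hD w hw hne]
    have hN : ‖N w‖ ≤ C * K * Real.exp (-α * |w.re|) := by
      simp only [N]
      rw [norm_mul]
      calc _ ≤ C * Real.exp (-α * |w.re|) * K :=
            mul_le_mul (hC w hw) r1 (norm_nonneg _) (by positivity)
        _ = _ := by ring
    have hB : ‖B w‖ ≤ ‖p + 1‖ / ε * K * Real.exp (-α * |w.re|) := by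
      simp only [B]
      rw [exp_div_sub_line_sum (hone w hw) h2, norm_mul, norm_div]
      have hX := Real.exp_pos w.re
      have hA := Real.exp_pos (-α * |w.re|)
      have a1 : ‖p + 1‖ / ‖1 + exp w‖ ≤ ‖p + 1‖ / ε * (1 / (1 + Real.exp w.re)) := by
        calc _ ≤ ‖p + 1‖ / (ε * (1 + Real.exp w.re)) := by gcongr; exact hε1 w hw
          _ = _ := by field_simp
      have a2 : 1 / (1 + Real.exp w.re) * ‖exp w / (p - exp w)‖
          ≤ K * Real.exp (-α * |w.re|) := by
        rw [one_div_mul_eq_div, div_le_iff₀ (by positivity), mul_assoc]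
        rcases le_total 0 w.re with h | h
        · refine r1.trans (le_mul_of_one_le_right hK ?_)
          have : 1 ≤ Real.exp (-α * |w.re|) * Real.exp w.re := by
            rw [← Real.exp_add, abs_of_nonneg h]
            exact Real.one_le_exp (by nlinarith)
          nlinarith
        · refine r2.trans (mul_le_mul_of_nonneg_left ?_ hK)
          have : Real.exp w.re ≤ Real.exp (-α * |w.re|) := by
            rw [abs_of_nonpos h]
            exact Real.exp_le_exp.2 (by nlinarith)
          nlinarith
      calc _ ≤ ‖p + 1‖ / ε * (1 / (1 + Real.exp w.re)) * ‖exp w / (p - exp w)‖ := by gcongr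
        _ = ‖p + 1‖ / ε * (1 / (1 + Real.exp w.re) * ‖exp w / (p - exp w)‖) := by ring
        _ ≤ ‖p + 1‖ / ε * (K * Real.exp (-α * |w.re|)) := by gcongr
        _ = _ := by ring
    calc _ ≤ ‖N w‖ + ‖Q w₀‖ * ‖B w‖ := by
          rw [← norm_mul]; exact norm_sub_le _ _
      _ ≤ C * K * Real.exp (-α * |w.re|)
          + ‖Q w₀‖ * (‖p + 1‖ / ε * K * Real.exp (-α * |w.re|)) := by gcongr
      _ = _ := by ring
  have line : ∀ y : ℝ, |y| = θ → Real.cos y < 0 →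
      Integrable (fun x : ℝ => N (x + y * I)) ∧ Integrable (fun x : ℝ => B (x + y * I)) ∧
      (fun x : ℝ => D (x + y * I)) = fun x : ℝ => N (x + y * I) - Q w₀ * B (x + y * I) := by
    intro y hy hyc
    have hratio : ∀ x : ℝ, p - exp (x + y * I) ≠ 0 ∧
        ‖exp (x + y * I) / (p - exp (x + y * I))‖ ≤ 1 / (-Real.cos y) := by
      intro x
      have hX := Real.exp_pos x
      have h1 : Real.exp x * (-Real.cos y) < ‖p - exp (x + y * I)‖ := by
        refine lt_of_lt_of_le ?_ (re_le_norm _)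
        simp [exp_re]; linarith
      have hpos : 0 < Real.exp x * (-Real.cos y) := by
        have : 0 < -Real.cos y := by linarith
        positivity
      refine ⟨norm_pos_iff.1 (hpos.trans h1), ?_⟩
      rw [norm_div, norm_exp, div_le_div_iff₀ (hpos.trans h1) (by linarith)]
      simpa using h1.le
    refine ⟨?_, integrable_log_deriv_line hp hyc (by rw [hy]; exact hθ2), ?_⟩
    · refine (integrable_resolventSymbol_line hα0 hα1 hl hθ0.le hθ2 hθ hy.le).mul_bdd
        (c := 1 / (-Real.cos y)) ?_ (Eventually.of_forall fun x => (hratio x).2)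
      exact Continuous.aestronglyMeasurable
        (by fun_prop (disch := exact fun x => (hratio x).1))
    · funext x
      refine hD _ (by simpa using hy.le) fun h => ?_
      have : |w₀.im| = θ := by rw [← h]; simpa using hy
      linarith
  obtain ⟨n1, b1, d1⟩ := line θ (abs_of_pos hθ0) hcos
  obtain ⟨n2, b2, d2⟩ := line (-θ) (by rw [abs_neg, abs_of_pos hθ0]) (by rwa [Real.cos_neg])
  have hstrip := integral_line_eq_of_differentiableOn_strip hθ0.le hα0
    (differentiableOn_strip_of_simple_pole hθ1 hθ2 hp hPd) hdecay
    (show Integrable fun x : ℝ => D (x + θ * I) by rw [d1]; exact n1.sub (b1.const_mul _))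
    (show Integrable fun x : ℝ => D (x + (-θ : ℝ) * I) by rw [d2]; exact n2.sub (b2.const_mul _))
  change ∫ x : ℝ, D (x + θ * I) = ∫ x : ℝ, D (x + (-θ : ℝ) * I) at hstrip
  rw [d1, d2, integral_sub n1 (b1.const_mul _), integral_sub n2 (b2.const_mul _),
    integral_const_mul, integral_const_mul] at hstrip
  have hlog := integral_log_deriv_line_sub hp hθ1 hθ2
  change (∫ x : ℝ, N (x + θ * I)) - (∫ x : ℝ, N (x + (-θ : ℝ) * I)) = _
  change (∫ x : ℝ, B (x + θ * I)) - (∫ x : ℝ, B (x + (-θ : ℝ) * I)) = _ at hlog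
  linear_combination hstrip + Q w₀ * hlog

/-! ### The integrable resolvent kernel -/

/-- The resolvent kernel: an integrable function on the half-line with Laplace transform
`1 / (p ^ α - l)`. -/
theorem exists_resolventKernel {α : ℝ} {l : ℂ} (hα0 : 0 < α) (hα1 : α < 1)
    (hl : l ∈ stableSector α) :
    ∃ r : ℝ → ℂ, IntegrableOn r (Ioi 0) ∧ ∀ p : ℂ, 0 < p.re →
      ∫ t in Ioi (0 : ℝ), exp (-p * t) * r t = 1 / (exp (α * log p) - l) := by
  obtain ⟨hl0, hl⟩ := hl
  have hpi := Real.pi_pos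
  -- `θ > π / 2` makes the exponentials decay along the rays, `θ < π` keeps the pole `s = -1`
  -- outside the sector, and `α * θ < |arg l|` excludes the zeros of `s ^ α - l`.
  obtain ⟨θ, hθ1, hθ'⟩ := exists_between (a₁ := Real.pi / 2) (a₂ := min Real.pi (|arg l| / α))
    (lt_min (by linarith) (by rw [lt_div_iff₀ hα0]; linarith))
  have hθ2 : θ < Real.pi := hθ'.trans_le (min_le_left _ _)
  have hθ : α * θ < |arg l| := by
    have := hθ'.trans_le (min_le_right _ _)
    rw [lt_div_iff₀ hα0] at this; linarith
  have hθ0 : 0 < θ := by linarith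
  have hcos : Real.cos θ < 0 := Real.cos_neg_of_pi_div_two_lt_of_lt hθ1 (by linarith)
  have hcos' : Real.cos (-θ) < 0 := by rwa [Real.cos_neg]
  have q1 := integrable_resolventSymbol_line hα0 hα1 hl0 hθ0.le hθ2 hθ (y := θ)
    (abs_of_pos hθ0).le
  have q2 := integrable_resolventSymbol_line hα0 hα1 hl0 hθ0.le hθ2 hθ (y := -θ)
    (by rw [abs_neg, abs_of_pos hθ0])
  set k₁ := rayKernel (fun x : ℝ => resolventSymbol α l (x + θ * I)) θ
  set k₂ := rayKernel (fun x : ℝ => resolventSymbol α l (x + (-θ : ℝ) * I)) (-θ)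
  have i1 : IntegrableOn k₁ (Ioi 0) := integrableOn_rayKernel q1 hcos
  have i2 : IntegrableOn k₂ (Ioi 0) := integrableOn_rayKernel q2 hcos'
  have i3 : IntegrableOn (fun t : ℝ => exp (-1 * t)) (Ioi 0) :=
    integrableOn_exp_mul_complex_Ioi (by simp) 0
  -- The last term has transform `1 / (l * (1 + p))` and undoes the correction in the symbol.
  refine ⟨fun t => (2 * Real.pi * I)⁻¹ * (k₁ t - k₂ t) - l⁻¹ * exp (-1 * t),
    ((i1.sub i2).const_mul _).sub (i3.const_mul _), fun p hp => ?_⟩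
  have mulexp : ∀ k : ℝ → ℂ, IntegrableOn k (Ioi 0) →
      IntegrableOn (fun t : ℝ => exp (-p * t) * k t) (Ioi 0) := fun k hk => by
    refine Integrable.bdd_mul (c := 1) hk (Continuous.aestronglyMeasurable (by fun_prop)) ?_
    filter_upwards [ae_restrict_mem measurableSet_Ioi] with t ht
    rw [norm_exp, Real.exp_le_one_iff]
    have := mul_pos hp (mem_Ioi.1 ht)
    simp; linarith
  have e : ∀ t : ℝ, exp (-p * t) * ((2 * Real.pi * I)⁻¹ * (k₁ t - k₂ t) - l⁻¹ * exp (-1 * t))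
      = (2 * Real.pi * I)⁻¹ * (exp (-p * t) * k₁ t - exp (-p * t) * k₂ t)
        - l⁻¹ * exp ((-p - 1) * t) := fun t => by
    rw [show (-p - 1) * (t : ℂ) = -p * t + -1 * t by ring, exp_add]; ring
  have hre : (-p - 1).re < 0 := by simp; linarith
  simp_rw [e]
  have hA : IntegrableOn (fun t : ℝ => (2 * Real.pi * I)⁻¹ *
      (exp (-p * t) * k₁ t - exp (-p * t) * k₂ t)) (Ioi 0) :=
    ((mulexp _ i1).sub (mulexp _ i2)).const_mul _
  rw [integral_sub hA ((integrableOn_exp_mul_complex_Ioi hre 0).const_mul _), integral_const_mul,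
    integral_const_mul, integral_sub (mulexp _ i1) (mulexp _ i2),
    laplace_rayKernel q1 hcos hp, laplace_rayKernel q2 hcos' hp,
    integral_resolventSymbol_cauchy hα0 hα1 hl0 hθ1 hθ2 hθ hp, integral_exp_mul_complex_Ioi hre]
  have hp0 : p ≠ 0 := by rintro rfl; simp at hp
  have h1 : 1 + p ≠ 0 := fun h => by have := congrArg re h; simp at this; linarith
  have h2 : -p - 1 ≠ 0 := fun h => h1 (by linear_combination -h)
  have h3 : exp (α * log p) - l ≠ 0 := by
    refine sub_ne_zero.2 (exp_mul_ne_of_abs_im_le hα0 hl0 hθ0.le hθ ?_)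
    rw [log_im]
    exact ((abs_arg_lt_pi_div_two_iff.2 (Or.inl hp)).trans hθ1).le
  rw [inv_mul_cancel_left₀ two_pi_I_ne_zero, resolventSymbol, exp_log hp0]
  simp
  field_simp
  ring

/-! ### Laplace transform of powers -/

/-- For real `p` this is the Gamma integral. In `z = -p` the left side is the complex moment
generating function of the density `t ^ (a - 1)`, analytic on `re z < 0`, so the identity theorem
extends the formula. -/
theorem laplace_rpow {a : ℝ} (ha : 0 < a) {p : ℂ} (hp : 0 < p.re) :
    ∫ t in Ioi (0 : ℝ), exp (-p * t) * ((t ^ (a - 1) : ℝ) : ℂ)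
      = Real.Gamma a * exp (-a * log p) := by
  set μ : Measure ℝ := (volume.restrict (Ioi 0)).withDensity
    (fun t => ENNReal.ofReal (t ^ (a - 1))) with hμ
  have hmeas : Measurable fun t : ℝ => ENNReal.ofReal (t ^ (a - 1)) := by fun_prop
  have hfin : ∀ᵐ t : ℝ ∂(volume.restrict (Ioi 0)), ENNReal.ofReal (t ^ (a - 1)) < ⊤ :=
    Eventually.of_forall fun _ => ENNReal.ofReal_lt_top
  have hset : Iio 0 ⊆ ProbabilityTheory.integrableExpSet id μ := by
    intro t ht
    have ht' : 0 < -t := by simpa using ht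
    change Integrable _ μ
    rw [hμ, integrable_withDensity_iff_integrable_smul' hmeas hfin]
    refine (integrableOn_rpow_mul_exp_neg_mul_rpow (s := a - 1) (p := 1) (b := -t)
      (by linarith) one_pos ht').congr_fun (fun x hx => ?_) measurableSet_Ioi
    have : 0 ≤ x ^ (a - 1) := Real.rpow_nonneg (mem_Ioi.1 hx).le _
    simp [ENNReal.toReal_ofReal this]
  have hF : ∀ z : ℂ, ProbabilityTheory.complexMGF id μ z
      = ∫ t in Ioi (0 : ℝ), exp (z * t) * ((t ^ (a - 1) : ℝ) : ℂ) := by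
    intro z
    rw [ProbabilityTheory.complexMGF, hμ, integral_withDensity_eq_integral_toReal_smul hmeas hfin]
    refine setIntegral_congr_fun measurableSet_Ioi fun x hx => ?_
    have : 0 ≤ x ^ (a - 1) := Real.rpow_nonneg (mem_Ioi.1 hx).le _
    simp only [ENNReal.toReal_ofReal this, id, real_smul, mul_comm]
  have hsub : {z : ℂ | z.re < 0} ⊆ {z | z.re ∈ interior (ProbabilityTheory.integrableExpSet id μ)} :=
    fun z hz => interior_mono hset (by rwa [isOpen_Iio.interior_eq])
  have hopen : IsOpen {z : ℂ | z.re < 0} := isOpen_lt continuous_re continuous_const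
  have hA : AnalyticOnNhd ℂ (ProbabilityTheory.complexMGF id μ) {z : ℂ | z.re < 0} :=
    ProbabilityTheory.analyticOnNhd_complexMGF.mono hsub
  have hB : AnalyticOnNhd ℂ (fun z : ℂ => Real.Gamma a * exp (-a * log (-z)))
      {z : ℂ | z.re < 0} := by
    refine DifferentiableOn.analyticOnNhd (fun z hz => ?_) hopen
    have : -z ∈ slitPlane := Or.inl (by simpa using hz)
    exact DifferentiableAt.differentiableWithinAt (by fun_prop (disch := assumption))
  have hconn : IsPreconnected {z : ℂ | z.re < 0} :=
    (convex_halfSpace_re_lt 0).isPreconnected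
  have hev : ∀ᶠ x : ℝ in 𝓝[≠] (-1), ProbabilityTheory.complexMGF id μ (x : ℂ)
      = Real.Gamma a * exp (-a * log (-(x : ℂ))) := by
    refine eventually_nhdsWithin_of_eventually_nhds ?_
    filter_upwards [Iio_mem_nhds (show (-1 : ℝ) < 0 by norm_num)] with x hx
    have hx' : 0 < -x := by simpa using hx
    have key := Real.integral_rpow_mul_exp_neg_mul_Ioi ha hx'
    rw [hF]
    have e : ∀ t : ℝ, exp (x * t) * ((t ^ (a - 1) : ℝ) : ℂ)
        = ((t ^ (a - 1) * Real.exp (-(-x * t)) : ℝ) : ℂ) := fun t => by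
      push_cast; rw [mul_comm]; ring_nf
    simp_rw [e]
    rw [integral_complex_ofReal, key, ← ofReal_neg x, ← ofReal_log hx'.le, one_div,
      Real.inv_rpow hx'.le, ← Real.rpow_neg hx'.le, Real.rpow_def_of_pos hx']
    push_cast
    ring_nf
  have htend : Tendsto (fun x : ℝ => (x : ℂ)) (𝓝[≠] (-1)) (𝓝[≠] (((-1 : ℝ) : ℂ))) := by
    refine tendsto_nhdsWithin_iff.2 ⟨?_, ?_⟩
    · exact (continuous_ofReal.tendsto _).mono_left nhdsWithin_le_nhds
    · filter_upwards [self_mem_nhdsWithin] with x hx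
      exact fun h => hx (ofReal_injective h)
  have := AnalyticOnNhd.eqOn_of_preconnected_of_frequently_eq hA hB hconn
    (z₀ := ((-1 : ℝ) : ℂ)) (by simp) (htend.frequently hev.frequently)
    (show -p ∈ {z : ℂ | z.re < 0} by simpa using hp)
  rw [hF] at this
  simpa using this

/-! ### Uniqueness for the Volterra equation by Fourier transform -/

/-- The function `t ↦ exp (-t) φ t`, cut off outside `s`. -/
noncomputable def expWeight (s : Set ℝ) (φ : ℝ → ℂ) : ℝ → ℂ :=
  s.indicator fun t => exp (-t) * φ t

theorem fourier_expWeight {s : Set ℝ} (hs : MeasurableSet s) (φ : ℝ → ℂ) (ξ : ℝ) :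
    𝓕 (expWeight s φ) ξ = ∫ t in s, exp (-(1 + 2 * Real.pi * ξ * I) * t) * φ t := by
  rw [Real.fourier_real_eq_integral_exp_smul, ← integral_indicator hs]
  congr 1 with t
  by_cases ht : t ∈ s
  · simp only [expWeight, indicator_of_mem ht, smul_eq_mul]
    rw [← mul_assoc, ← exp_add]
    congr 2
    push_cast
    ring
  · simp [expWeight, indicator_of_notMem ht]

theorem integrable_expWeight {s : Set ℝ} (hs : MeasurableSet s) (hs0 : s ⊆ Ici 0) {φ : ℝ → ℂ}
    (hφ : IntegrableOn φ s) : Integrable (expWeight s φ) := by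
  refine IntegrableOn.integrable_indicator ?_ hs
  refine Integrable.bdd_mul (c := 1) hφ (Continuous.aestronglyMeasurable (by fun_prop)) ?_
  filter_upwards [ae_restrict_mem hs] with t ht
  rw [norm_exp, Real.exp_le_one_iff]
  simpa using hs0 ht

/-- The weights multiply to `exp (-t)`, and by causality the cut-off at `T` is invisible at times up
to `T`. -/
theorem expWeight_convolution_apply (φ ψ : ℝ → ℂ) {t T : ℝ} (ht : t ≤ T) :
    (expWeight (Ioi 0) φ ⋆[ContinuousLinearMap.mul ℂ ℂ] expWeight (Ioc 0 T) ψ) t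
      = exp (-t) * ∫ τ in Ioo 0 t, φ (t - τ) * ψ τ := by
  rw [convolution_mul_swap, ← integral_const_mul, ← integral_indicator measurableSet_Ioo]
  congr 1 with τ
  by_cases hτ : τ ∈ Ioo 0 t
  · rw [indicator_of_mem hτ, expWeight, expWeight,
      indicator_of_mem (show t - τ ∈ Ioi (0 : ℝ) by simpa using hτ.2),
      indicator_of_mem (show τ ∈ Ioc 0 T from ⟨hτ.1, hτ.2.le.trans ht⟩)]
    rw [mul_mul_mul_comm, ← exp_add]
    congr 2
    push_cast
    ring
  · rw [indicator_of_notMem hτ]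
    by_cases h0 : 0 < τ
    · have : t - τ ∉ Ioi (0 : ℝ) := fun h => hτ ⟨h0, by simpa using h⟩
      rw [expWeight, indicator_of_notMem this, zero_mul]
    · have : τ ∉ Ioc 0 T := fun h => h0 h.1
      rw [expWeight, expWeight, indicator_of_notMem this, mul_zero]

theorem fourier_sub_apply {f g : ℝ → ℂ} (hf : Integrable f) (hg : Integrable g) (ξ : ℝ) :
    𝓕 (fun x => f x - g x) ξ = 𝓕 f ξ - 𝓕 g ξ := by
  simp only [Real.fourier_eq, smul_sub]
  exact integral_sub ((Real.fourierIntegral_convergent_iff ξ).2 hf)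
    ((Real.fourierIntegral_convergent_iff ξ).2 hg)

theorem eq_zero_of_fourier_eq_zero {f : ℝ → ℂ} (hf : Integrable f) (h : ∀ ξ, 𝓕 f ξ = 0) {t : ℝ}
    (ht : ContinuousAt f t) : f t = 0 := by
  have h0 : 𝓕 f = fun _ => 0 := funext h
  rw [← hf.fourierInv_fourier_eq (by rw [h0]; exact integrable_zero _ _ _) ht, h0,
    Real.fourierInv_eq]
  simp

theorem ae_eq_zero_of_integral_exp_mul_eq_zero {W : ℝ → ℂ} (hW : Integrable W) {T : ℝ}
    (h : ∀ t ∈ Ioo 0 T, ∫ τ in (0 : ℝ)..t, exp τ * W τ = 0) : ∀ᵐ t, t ∈ Ioo 0 T → W t = 0 := by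
  have hloc : LocallyIntegrable fun τ : ℝ => exp τ * W τ :=
    hW.locallyIntegrable.continuous_mul (g := fun τ : ℝ => exp τ) (by fun_prop)
  filter_upwards [LocallyIntegrable.ae_hasDerivAt_integral hloc] with t ht htT
  have h0 : HasDerivAt (fun _ : ℝ => (0 : ℂ)) (exp t * W t) t := by
    refine (ht 0).congr_of_eventuallyEq ?_
    filter_upwards [isOpen_Ioo.mem_nhds htT] with x hx using (h x hx).symm
  have := h0.unique (hasDerivAt_const t 0)
  exact (mul_eq_zero.1 this).resolve_left (exp_ne_zero _)

theorem expWeight_one_convolution_apply {W : ℝ → ℂ} (hW : ∀ t ≤ 0, W t = 0) {t : ℝ} (ht : 0 ≤ t) :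
    (expWeight (Ioi 0) (fun _ => 1) ⋆[ContinuousLinearMap.mul ℂ ℂ] W) t
      = exp (-t) * ∫ τ in (0 : ℝ)..t, exp τ * W τ := by
  rw [convolution_mul_swap, intervalIntegral.integral_of_le ht, integral_Ioc_eq_integral_Ioo,
    ← integral_const_mul, ← integral_indicator measurableSet_Ioo]
  congr 1 with τ
  by_cases hτ : τ ∈ Ioo 0 t
  · rw [indicator_of_mem hτ, expWeight,
      indicator_of_mem (show t - τ ∈ Ioi (0 : ℝ) by simpa using hτ.2), ← mul_assoc, ← exp_add]
    simp only [mul_one]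
    congr 2
    push_cast
    ring
  · rw [indicator_of_notMem hτ]
    by_cases h0 : 0 < τ
    · have : t - τ ∉ Ioi (0 : ℝ) := fun h => hτ ⟨h0, by simpa using h⟩
      rw [expWeight, indicator_of_notMem this, zero_mul]
    · rw [hW τ (not_lt.1 h0), mul_zero]

theorem integrableOn_Ioc_of_continuousOn {v : ℝ → ℂ} (hv : ContinuousOn v (Ici 0)) (T : ℝ) :
    IntegrableOn v (Ioc 0 T) :=
  ((hv.mono Icc_subset_Ici_self).integrableOn_compact isCompact_Icc).mono_set Ioc_subset_Icc_self

theorem fourier_rlKernel {α : ℝ} (hα1 : α < 1) (ξ : ℝ) :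
    𝓕 (expWeight (Ioi 0) fun t => ((1 / Real.Gamma (1 - α) : ℝ) : ℂ) * ((t ^ (-α) : ℝ) : ℂ)) ξ
      = exp (α * log (1 + 2 * Real.pi * ξ * I)) / (1 + 2 * Real.pi * ξ * I) := by
  have hp : 0 < (1 + 2 * Real.pi * ξ * I : ℂ).re := by simp
  have hp0 : (1 + 2 * Real.pi * ξ * I : ℂ) ≠ 0 := fun h => by rw [h] at hp; simp at hp
  rw [fourier_expWeight measurableSet_Ioi]
  set p : ℂ := 1 + 2 * Real.pi * ξ * I
  have hL := laplace_rpow (a := 1 - α) (by linarith) hp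
  rw [show 1 - α - 1 = -α by ring] at hL
  simp_rw [mul_left_comm _ ((1 / Real.Gamma (1 - α) : ℝ) : ℂ)]
  rw [integral_const_mul, hL]
  have hG : (Real.Gamma (1 - α) : ℂ) ≠ 0 :=
    ofReal_ne_zero.2 (Real.Gamma_pos_of_pos (by linarith)).ne'
  have e : exp (-((1 - α : ℝ) : ℂ) * log p) = exp (α * log p) / p := by
    rw [show -((1 - α : ℝ) : ℂ) * log p = α * log p - log p by push_cast; ring, exp_sub,
      exp_log hp0]
  rw [e]
  push_cast
  field_simp

theorem fourier_expWeight_one (ξ : ℝ) :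
    𝓕 (expWeight (Ioi 0) fun _ => 1) ξ = 1 / (1 + 2 * Real.pi * ξ * I) := by
  have hp : 0 < (1 + 2 * Real.pi * ξ * I : ℂ).re := by simp
  rw [fourier_expWeight measurableSet_Ioi]
  set p : ℂ := 1 + 2 * Real.pi * ξ * I
  simp only [mul_one]
  rw [integral_exp_mul_complex_Ioi (by simpa using hp)]
  simp

theorem integrable_expWeight_rlKernel {α : ℝ} (hα1 : α < 1) :
    Integrable
      (expWeight (Ioi 0) fun t => ((1 / Real.Gamma (1 - α) : ℝ) : ℂ) * ((t ^ (-α) : ℝ) : ℂ)) := by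
  refine IntegrableOn.integrable_indicator ?_ measurableSet_Ioi
  have := (Real.GammaIntegral_convergent (s := 1 - α) (by linarith)).ofReal (𝕜 := ℂ)
  refine (this.const_mul ((1 / Real.Gamma (1 - α) : ℝ) : ℂ)).congr
    (Eventually.of_forall fun t => ?_)
  simp only [show 1 - α - 1 = -α by ring]
  push_cast
  simp only [coe_algebraMap]
  push_cast
  ring

theorem integrable_expWeight_one : Integrable (expWeight (Ioi 0) fun _ => 1) := by
  refine IntegrableOn.integrable_indicator ?_ measurableSet_Ioi
  simpa using integrableOn_exp_mul_complex_Ioi (a := -1) (by simp) 0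

/-- The solution of the Abel-type Volterra equation in terms of the resolvent kernel. -/
theorem ae_eq_resolvent_convolution {α : ℝ} {l : ℂ} (hα0 : 0 < α) (hα1 : α < 1)
    (hl : l ∈ stableSector α) {r : ℝ → ℂ} (hr : IntegrableOn r (Ioi 0))
    (hlap : ∀ p : ℂ, 0 < p.re →
      ∫ t in Ioi (0 : ℝ), exp (-p * t) * r t = 1 / (exp (α * log p) - l))
    {v f : ℝ → ℂ} (hv : ContinuousOn v (Ici 0)) (hf : ContinuousOn f (Ici 0))
    (heq : ∀ t : ℝ, 0 < t → ∫ τ in Ioo 0 t,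
      ((1 / Real.Gamma (1 - α) : ℝ) : ℂ) * (((t - τ) ^ (-α) : ℝ) : ℂ) * v τ
        = ∫ τ in Ioo 0 t, (l * v τ + f τ)) (T : ℝ) :
    ∀ᵐ t, t ∈ Ioo 0 T → v t = ∫ τ in Ioo 0 t, r (t - τ) * f τ := by
  set kk := expWeight (Ioi 0)
    fun t => ((1 / Real.Gamma (1 - α) : ℝ) : ℂ) * ((t ^ (-α) : ℝ) : ℂ) with hkk
  set oo := expWeight (Ioi 0) fun _ => 1 with hoo
  set rr := expWeight (Ioi 0) r with hrr
  set vv := expWeight (Ioc 0 T) v with hvv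
  set ff := expWeight (Ioc 0 T) f with hff
  set gg := expWeight (Ioc 0 T) (fun τ => l * v τ + f τ) with hgg
  have hs0 : Ioc 0 T ⊆ Ici 0 := fun x hx => hx.1.le
  have iv := integrableOn_Ioc_of_continuousOn hv T
  have if' := integrableOn_Ioc_of_continuousOn hf T
  have ikk : Integrable kk := integrable_expWeight_rlKernel hα1
  have ioo : Integrable oo := integrable_expWeight_one
  have irr : Integrable rr := integrable_expWeight measurableSet_Ioi Ioi_subset_Ici_self hr
  have ivv : Integrable vv := integrable_expWeight measurableSet_Ioc hs0 iv
  have iff' : Integrable ff := integrable_expWeight measurableSet_Ioc hs0 if'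
  have igg : Integrable gg := integrable_expWeight measurableSet_Ioc hs0 ((iv.const_mul l).add if')
  let m := ContinuousLinearMap.mul ℂ ℂ
  have conv : ∀ {a b : ℝ → ℂ}, Integrable a → Integrable b → Integrable (a ⋆[m] b) :=
    fun ha hb => Integrable.integrable_convolution _ ha hb
  -- `D` is the defect of the truncated equation, known to vanish only up to `T`. `W` is the error
  -- of the claimed formula. `Z` combines them so that its transform vanishes identically although
  -- `D` does not.
  set D : ℝ → ℂ := fun t => (kk ⋆[m] vv) t - (oo ⋆[m] gg) t with hDdef
  set W : ℝ → ℂ := fun t => vv t - (rr ⋆[m] ff) t with hWdef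
  set Z : ℝ → ℂ := fun t => (oo ⋆[m] W) t - (rr ⋆[m] D) t with hZdef
  have iD : Integrable D := (conv ikk ivv).sub (conv ioo igg)
  have iW : Integrable W := ivv.sub (conv irr iff')
  have iZ : Integrable Z := (conv ioo iW).sub (conv irr iD)
  have hgghat : ∀ ξ, 𝓕 gg ξ = l * 𝓕 vv ξ + 𝓕 ff ξ := by
    intro ξ
    have : gg = fun t => l * vv t - -ff t := by
      funext t
      by_cases ht : t ∈ Ioc 0 T
      · simp only [hgg, hvv, hff, expWeight, indicator_of_mem ht]; ring
      · simp only [hgg, hvv, hff, expWeight, indicator_of_notMem ht]; ring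
    rw [this, fourier_sub_apply (g := fun t => -ff t) (ivv.const_mul l) iff'.neg]
    have h1 : 𝓕 (fun t => l * vv t) ξ = l * 𝓕 vv ξ := by
      simp only [Real.fourier_eq]
      rw [← integral_const_mul]
      congr 1 with t
      simp only [Circle.smul_def, smul_eq_mul]
      ring
    have h2 : 𝓕 (fun t => -ff t) ξ = -𝓕 ff ξ := by
      simp only [Real.fourier_eq, smul_neg, integral_neg]
    rw [h1, h2, sub_neg_eq_add]
  -- With `p = 1 + 2πiξ`, the transforms of `oo`, `kk`, `rr` are `1 / p`, `p ^ α / p`, `1 / (p ^ α -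
  -- l)`. The terms in the forcing cancel, as do those in `vv`.
  have hZhat : ∀ ξ, 𝓕 Z ξ = 0 := by
    intro ξ
    have hp : 0 < (1 + 2 * Real.pi * ξ * I : ℂ).re := by simp
    rw [hZdef, fourier_sub_apply (conv ioo iW) (conv irr iD),
      Real.fourier_mul_convolution_eq ioo iW, Real.fourier_mul_convolution_eq irr iD,
      hWdef, hDdef, fourier_sub_apply ivv (conv irr iff'),
      fourier_sub_apply (conv ikk ivv) (conv ioo igg),
      Real.fourier_mul_convolution_eq irr iff', Real.fourier_mul_convolution_eq ikk ivv,
      Real.fourier_mul_convolution_eq ioo igg, hgghat, hkk, hoo, fourier_rlKernel hα1,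
      fourier_expWeight_one, hrr, fourier_expWeight measurableSet_Ioi, hlap _ hp]
    set p : ℂ := 1 + 2 * Real.pi * ξ * I
    have hp0 : p ≠ 0 := fun h => by rw [h] at hp; simp at hp
    have hE : exp (α * log p) - l ≠ 0 := by
      refine sub_ne_zero.2 (exp_mul_ne_of_abs_im_le (θ := Real.pi / 2) hα0 hl.1
        (by positivity) (by have := hl.2; linarith) ?_)
      rw [log_im]
      exact (abs_arg_lt_pi_div_two_iff.2 (Or.inl hp)).le
    field_simp
    ring
  have hD0 : ∀ t ≤ T, D t = 0 := by
    intro t ht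
    simp only [hDdef, hkk, hoo, hvv, hgg, m]
    rw [expWeight_convolution_apply _ _ ht, expWeight_convolution_apply _ _ ht]
    rcases le_or_gt t 0 with h | h
    · simp [Ioo_eq_empty (not_lt.2 h)]
    · simp only [one_mul]
      rw [heq t h, sub_self]
  -- `rr` lives on positive times, so at time `t` only values of `D` before `t` enter.
  have hrD : ∀ t ≤ T, (rr ⋆[m] D) t = 0 := by
    intro t ht
    rw [convolution_def]
    refine integral_eq_zero_of_ae (Eventually.of_forall fun τ => ?_)
    by_cases hτ : τ ∈ Ioi (0 : ℝ)
    · have : D (t - τ) = 0 := hD0 _ (by have := mem_Ioi.1 hτ; linarith)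
      simp [this]
    · have : rr τ = 0 := by rw [hrr, expWeight, indicator_of_notMem hτ]
      simp [this]
  have hW0 : 0 ≤ T → ∀ t ≤ 0, W t = 0 := by
    intro hT t ht
    simp only [hWdef, hrr, hff, m]
    rw [expWeight_convolution_apply _ _ (ht.trans hT), Ioo_eq_empty (not_lt.2 ht), hvv, expWeight,
      indicator_of_notMem (fun h => not_lt.2 ht h.1)]
    simp
  have hint : ∀ t ∈ Ioo 0 T, ∫ τ in (0 : ℝ)..t, exp τ * W τ = 0 := by
    intro t ht
    have hT : 0 ≤ T := (ht.1.trans ht.2).le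
    have hloc : LocallyIntegrable fun τ : ℝ => exp τ * W τ :=
      iW.locallyIntegrable.continuous_mul (g := fun τ : ℝ => exp τ) (by fun_prop)
    have hcont : Continuous fun t : ℝ => exp (-t) * ∫ τ in (0 : ℝ)..t, exp τ * W τ :=
      Continuous.mul (by fun_prop) (intervalIntegral.continuous_primitive
        (fun a b => intervalIntegrable_iff.mpr
          ((hloc.integrableOn_isCompact isCompact_uIcc).mono_set uIoc_subset_uIcc)) 0)
    have hev : ∀ s ∈ Ioo 0 T, Z s = exp (-s) * ∫ τ in (0 : ℝ)..s, exp τ * W τ := by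
      intro s hs
      simp only [hZdef, m]
      rw [hrD s hs.2.le, sub_zero, hoo, expWeight_one_convolution_apply (hW0 hT) hs.1.le]
    -- Convolution with `oo` turns `W` into a weighted primitive, which is continuous; this permits
    -- pointwise Fourier inversion. Differentiating the primitive later recovers `W` almost
    -- everywhere.
    have hZc : ContinuousAt Z t := by
      refine hcont.continuousAt.congr ?_
      filter_upwards [isOpen_Ioo.mem_nhds ht] with s hs using (hev s hs).symm
    have := eq_zero_of_fourier_eq_zero iZ hZhat hZc
    rw [hev t ht] at this
    exact (mul_eq_zero.1 this).resolve_left (exp_ne_zero _)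
  filter_upwards [ae_eq_zero_of_integral_exp_mul_eq_zero iW hint] with t ht htT
  have h := ht htT
  simp only [hWdef, hrr, hff, m] at h
  rw [expWeight_convolution_apply _ _ htT.2.le, hvv, expWeight,
    indicator_of_mem (show t ∈ Ioc 0 T from ⟨htT.1, htT.2.le⟩), ← mul_sub] at h
  exact sub_eq_zero.1 ((mul_eq_zero.1 h).resolve_left (exp_ne_zero _))

/-! ### From the Caputo equation to its integrated form -/

theorem norm_rlIntegral_le {α : ℝ} (hα1 : α < 1) {v : ℝ → ℂ} {M T : ℝ}
    (hM : ∀ t ∈ Icc 0 T, ‖v t‖ ≤ M) {t : ℝ} (ht : t ∈ Icc 0 T) :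
    ‖rlIntegral 0 (1 - α) v t‖
      ≤ 1 / Real.Gamma (1 - α) * (M * (t ^ (1 - α) / (1 - α))) := by
  have hG : 0 < Real.Gamma (1 - α) := Real.Gamma_pos_of_pos (by linarith)
  have hint : IntervalIntegrable (fun τ : ℝ => M * (t - τ) ^ (1 - α - 1)) volume 0 t := by
    have := (intervalIntegral.intervalIntegrable_rpow' (a := t) (b := 0) (r := 1 - α - 1)
      (by linarith)).comp_sub_left t
    simpa using this.const_mul M
  have hb := intervalIntegral.norm_integral_le_of_norm_le ht.1
    (f := fun τ : ℝ => (((t - τ) ^ (1 - α - 1) : ℝ) : ℂ) * v τ)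
    (g := fun τ : ℝ => M * (t - τ) ^ (1 - α - 1)) (Eventually.of_forall fun τ hτ => ?_) hint
  · have hval : ∫ τ in (0 : ℝ)..t, (t - τ) ^ (1 - α - 1) = t ^ (1 - α) / (1 - α) := by
      rw [intervalIntegral.integral_comp_sub_left (fun x => x ^ (1 - α - 1)), sub_self, sub_zero,
        integral_rpow (Or.inl (by linarith))]
      rw [sub_add_cancel, Real.zero_rpow (by linarith), sub_zero]
    rw [intervalIntegral.integral_const_mul, hval] at hb
    rw [rlIntegral, norm_mul, norm_real, Real.norm_of_nonneg (by positivity)]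
    gcongr
  · have h0 : 0 ≤ (t - τ) ^ (1 - α - 1) := Real.rpow_nonneg (by linarith [hτ.2]) _
    rw [norm_mul, norm_real, Real.norm_of_nonneg h0, mul_comm]
    exact mul_le_mul_of_nonneg_right (hM τ ⟨hτ.1.le, hτ.2.trans ht.2⟩) h0

/-- Integrated form of a Caputo equation with continuous right-hand side. -/
theorem rlIntegral_eq_integral_of_hasCaputoDerivAt {α : ℝ} (hα1 : α < 1) {u w : ℝ → ℂ}
    (hu : ContinuousOn u (Ici 0)) (hw : ContinuousOn w (Ici 0))
    (h : ∀ t : ℝ, 0 < t → HasCaputoDerivAt 0 α u (w t) t) {t : ℝ} (ht : 0 < t) :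
    rlIntegral 0 (1 - α) (fun τ => u τ - u 0) t = ∫ τ in (0 : ℝ)..t, w τ := by
  set G := rlIntegral 0 (1 - α) (fun τ => u τ - u 0) with hG
  have hG0 : G 0 = 0 := by simp [hG, rlIntegral]
  obtain ⟨M, hM⟩ := (isCompact_Icc (a := (0 : ℝ)) (b := t)).exists_bound_of_continuousOn
    (f := fun τ => u τ - u 0) ((hu.mono Icc_subset_Ici_self).sub continuousOn_const)
  -- The equation gives differentiability only for positive times. Continuity at `0` comes from the
  -- bound of order `s ^ (1 - α)`.
  have hcont : ContinuousOn G (Icc 0 t) := by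
    intro s hs
    rcases hs.1.eq_or_lt with rfl | hpos
    · rw [ContinuousWithinAt, hG0]
      have hlim : Tendsto (fun s : ℝ => 1 / Real.Gamma (1 - α) * (M * (s ^ (1 - α) / (1 - α))))
          (𝓝[Icc 0 t] 0) (𝓝 0) := by
        have h1 : ContinuousAt (fun s : ℝ => 1 / Real.Gamma (1 - α) *
            (M * (s ^ (1 - α) / (1 - α)))) 0 := by
          have := Real.continuousAt_rpow_const 0 (1 - α) (Or.inr (by linarith))
          exact continuousAt_const.mul (continuousAt_const.mul (this.div_const _))
        have h2 := h1.tendsto.mono_left (nhdsWithin_le_nhds (s := Icc 0 t))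
        simpa [Real.zero_rpow (show (1 - α) ≠ 0 by linarith)] using h2
      refine squeeze_zero_norm' ?_ hlim
      filter_upwards [self_mem_nhdsWithin] with s hs using norm_rlIntegral_le hα1 hM hs
    · exact (h s hpos).continuousAt.continuousWithinAt
  have := intervalIntegral.integral_eq_sub_of_hasDerivAt_of_le ht.le hcont
    (fun s hs => h s hs.1) ((hw.mono (by
      rw [uIcc_of_le ht.le]; exact Icc_subset_Ici_self)).intervalIntegrable)
  rw [this, hG0, sub_zero]

/-! ### Convolution with an integrable kernel -/

/-- Moving the dependence on `t` from the domain into the integrand prepares dominated convergence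
as `t → ∞`, with majorant `‖r s‖ * F`. -/
theorem setIntegral_Ioo_comp_sub_eq (r f : ℝ → ℂ) (t : ℝ) :
    ∫ τ in Ioo 0 t, r (t - τ) * f τ
      = ∫ s in Ioi 0, r s * (Iio t).indicator (fun s => f (t - s)) s := by
  rw [← integral_indicator measurableSet_Ioo, ← integral_indicator measurableSet_Ioi,
    ← integral_sub_left_eq_self _ volume t]
  congr 1 with s
  by_cases h1 : s ∈ Ioi (0 : ℝ)
  · by_cases h2 : s ∈ Iio t
    · rw [indicator_of_mem h1, indicator_of_mem h2, indicator_of_mem, sub_sub_cancel]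
      exact ⟨by simpa using h2, by simpa using h1⟩
    · rw [indicator_of_mem h1, indicator_of_notMem h2, indicator_of_notMem, mul_zero]
      exact fun h => h2 (by simpa using h.1)
  · rw [indicator_of_notMem h1, indicator_of_notMem]
    exact fun h => h1 (by simpa using h.2)

theorem norm_resolvent_convolution_le {r f : ℝ → ℂ} (hr : IntegrableOn r (Ioi 0)) {F : ℝ}
    (hF : ∀ t, 0 ≤ t → ‖f t‖ ≤ F) (t : ℝ) :
    ‖∫ τ in Ioo 0 t, r (t - τ) * f τ‖ ≤ (∫ s in Ioi 0, ‖r s‖) * F := by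
  have hF0 : 0 ≤ F := (norm_nonneg _).trans (hF 0 le_rfl)
  rw [setIntegral_Ioo_comp_sub_eq, ← integral_mul_const]
  refine norm_integral_le_of_norm_le (hr.norm.mul_const F) (Eventually.of_forall fun s => ?_)
  rw [norm_mul]
  refine mul_le_mul_of_nonneg_left ?_ (norm_nonneg _)
  by_cases h : s ∈ Iio t
  · rw [indicator_of_mem h]; exact hF _ (by have := mem_Iio.1 h; linarith)
  · rw [indicator_of_notMem h, norm_zero]; exact hF0

theorem tendsto_resolvent_convolution {r f : ℝ → ℂ} (hr : IntegrableOn r (Ioi 0)) {F : ℝ}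
    (hf : ContinuousOn f (Ici 0)) (hF : ∀ t, 0 ≤ t → ‖f t‖ ≤ F) {c : ℂ}
    (hc : Tendsto f atTop (𝓝 c)) :
    Tendsto (fun t => ∫ τ in Ioo 0 t, r (t - τ) * f τ) atTop (𝓝 ((∫ s in Ioi 0, r s) * c)) := by
  have hF0 : 0 ≤ F := (norm_nonneg _).trans (hF 0 le_rfl)
  simp_rw [setIntegral_Ioo_comp_sub_eq]
  rw [← integral_mul_const]
  refine tendsto_integral_filter_of_dominated_convergence (fun s => ‖r s‖ * F)
    (Eventually.of_forall fun t => ?_) (Eventually.of_forall fun t => Eventually.of_forall fun s => ?_)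
    (hr.norm.mul_const F) (Eventually.of_forall fun s => ?_)
  · refine hr.1.mul (AEStronglyMeasurable.mono_measure ?_ Measure.restrict_le_self)
    rw [aestronglyMeasurable_indicator_iff measurableSet_Iio]
    refine ContinuousOn.aestronglyMeasurable ?_ measurableSet_Iio
    exact hf.comp (by fun_prop) fun s hs => by simpa using (mem_Iio.1 hs).le
  · rw [norm_mul]
    refine mul_le_mul_of_nonneg_left ?_ (norm_nonneg _)
    by_cases h : s ∈ Iio t
    · rw [indicator_of_mem h]; exact hF _ (by have := mem_Iio.1 h; linarith)
    · rw [indicator_of_notMem h, norm_zero]; exact hF0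
  · refine Tendsto.const_mul _ ((hc.comp (tendsto_atTop_add_const_right atTop (-s)
      tendsto_id)).congr' ?_)
    filter_upwards [eventually_gt_atTop s] with t ht
    rw [indicator_of_mem (mem_Iio.2 ht)]
    simp [sub_eq_add_neg]

/-- A violation would persist on a nonempty open set, which meets every set of full measure. This
upgrades the almost-everywhere representation to bounds at every time. -/
theorem norm_sub_le_of_ae {v : ℝ → ℂ} (hv : ContinuousOn v (Ici 0)) {a B : ℝ} {c : ℂ} (ha : 0 ≤ a)
    (h : ∀ᵐ t, a < t → ‖v t - c‖ ≤ B) {t : ℝ} (ht : a < t) : ‖v t - c‖ ≤ B := by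
  by_contra! hlt
  have hopen : IsOpen (Ioi a ∩ (fun t => ‖v t - c‖) ⁻¹' Ioi B) := by
    refine ContinuousOn.isOpen_inter_preimage ?_ isOpen_Ioi isOpen_Ioi
    exact ((hv.mono (Ioi_subset_Ici_self.trans (Ici_subset_Ici.2 ha))).sub
      continuousOn_const).norm
  obtain ⟨s, ⟨hs1, hs2⟩, hs⟩ := (Measure.dense_of_ae h).inter_open_nonempty _ hopen ⟨t, ht, hlt⟩
  exact absurd (hs hs1) (not_le.2 hs2)

/-- Let `p` decrease to `0` in the Laplace transform; `‖r‖` dominates the integrand and `p ^ α → 0`.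
-/
theorem integral_resolventKernel {α : ℝ} {l : ℂ} (hα0 : 0 < α) (hl : l ≠ 0) {r : ℝ → ℂ}
    (hr : IntegrableOn r (Ioi 0))
    (hlap : ∀ p : ℂ, 0 < p.re →
      ∫ t in Ioi (0 : ℝ), exp (-p * t) * r t = 1 / (exp (α * log p) - l)) :
    ∫ t in Ioi (0 : ℝ), r t = -l⁻¹ := by
  have h1 : Tendsto (fun p : ℝ => ∫ t in Ioi (0 : ℝ), exp (-p * t) * r t) (𝓝[>] 0)
      (𝓝 (∫ t in Ioi (0 : ℝ), r t)) := by
    refine tendsto_integral_filter_of_dominated_convergence (fun t => ‖r t‖)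
      (Eventually.of_forall fun p => ?_) ?_ hr.norm (Eventually.of_forall fun t => ?_)
    · exact (Continuous.aestronglyMeasurable (by fun_prop)).mul hr.1
    · filter_upwards [self_mem_nhdsWithin] with p hp
      filter_upwards [ae_restrict_mem measurableSet_Ioi] with t ht
      rw [norm_mul]
      refine mul_le_of_le_one_left (norm_nonneg _) ?_
      rw [norm_exp, Real.exp_le_one_iff]
      have := mul_pos (mem_Ioi.1 hp) (mem_Ioi.1 ht)
      simp
      linarith
    · have : Continuous fun p : ℝ => exp (-p * t) * r t := by fun_prop
      have := (this.tendsto 0).mono_left (nhdsWithin_le_nhds (s := Ioi 0))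
      simpa using this
  have h2 : Tendsto (fun p : ℝ => 1 / (((p ^ α : ℝ) : ℂ) - l)) (𝓝[>] 0) (𝓝 (-l⁻¹)) := by
    have h3 : Tendsto (fun p : ℝ => ((p ^ α : ℝ) : ℂ)) (𝓝[>] 0) (𝓝 0) := by
      have h4 := ((Real.continuousAt_rpow_const 0 α (Or.inr hα0.le)).tendsto).mono_left
        (nhdsWithin_le_nhds (s := Ioi 0))
      rw [Real.zero_rpow hα0.ne'] at h4
      simpa [Function.comp_def] using (continuous_ofReal.tendsto 0).comp h4
    have := (h3.sub_const l).inv₀ (by simpa using hl)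
    simpa using this
  refine tendsto_nhds_unique h1 (h2.congr' ?_)
  filter_upwards [self_mem_nhdsWithin] with p hp
  have hp' := mem_Ioi.1 hp
  rw [hlap p (by simpa using hp'), Real.rpow_def_of_pos hp', ← ofReal_log hp'.le]
  push_cast
  rw [mul_comm]

/-! ### The scalar equation -/

section Scalar

variable {α : ℝ} {l : ℂ} {u h : ℝ → ℂ}

theorem exists_kernel_representation (hα0 : 0 < α) (hα1 : α < 1) (hl : l ∈ stableSector α)
    (hu : ContinuousOn u (Ici 0)) (hh : ContinuousOn h (Ici 0))
    (heq : ∀ t : ℝ, 0 < t → HasCaputoDerivAt 0 α u (l * u t + h t) t) :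
    ∃ r : ℝ → ℂ, IntegrableOn r (Ioi 0) ∧ ∫ t in Ioi (0 : ℝ), r t = -l⁻¹ ∧
      ∀ᵐ t, 0 < t → u t - u 0 = ∫ τ in Ioo 0 t, r (t - τ) * (h τ + l * u 0) := by
  obtain ⟨r, hr, hlap⟩ := exists_resolventKernel hα0 hα1 hl
  refine ⟨r, hr, integral_resolventKernel hα0 hl.1 hr hlap, ?_⟩
  have key := ae_eq_resolvent_convolution hα0 hα1 hl hr hlap (v := fun t => u t - u 0)
    (f := fun t => h t + l * u 0) (hu.sub continuousOn_const) (hh.add continuousOn_const) ?_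
  -- The exceptional null set depends on the horizon; integer horizons suffice and their null sets
  -- have a null union.
  · have hall := ae_all_iff.2 fun n : ℕ => key n
    filter_upwards [hall] with t ht htpos
    obtain ⟨n, hn⟩ := exists_nat_gt t
    exact ht n ⟨htpos, hn⟩
  · intro t ht
    have hint := rlIntegral_eq_integral_of_hasCaputoDerivAt (w := fun t => l * u t + h t) hα1 hu
      ((continuousOn_const.mul hu).add hh) heq ht
    rw [rlIntegral, intervalIntegral.integral_of_le ht.le, intervalIntegral.integral_of_le ht.le,
      integral_Ioc_eq_integral_Ioo, integral_Ioc_eq_integral_Ioo, ← integral_const_mul,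
      show 1 - α - 1 = -α by ring] at hint
    simp_rw [← mul_assoc] at hint
    rw [hint]
    congr 1 with τ
    ring

theorem bounded_of_hasCaputoDerivAt (hα0 : 0 < α) (hα1 : α < 1) (hl : l ∈ stableSector α)
    (hu : ContinuousOn u (Ici 0)) (hh : BddCont h)
    (heq : ∀ t : ℝ, 0 < t → HasCaputoDerivAt 0 α u (l * u t + h t) t) :
    ∃ M : ℝ, ∀ t : ℝ, 0 ≤ t → ‖u t‖ ≤ M := by
  obtain ⟨r, hr, -, hae⟩ := exists_kernel_representation hα0 hα1 hl hu hh.1 heq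
  obtain ⟨H, hH⟩ := hh.2
  set B := (∫ s in Ioi 0, ‖r s‖) * (H + ‖l * u 0‖)
  have hB : ∀ t, 0 < t → ‖u t - u 0‖ ≤ B := fun t ht => by
    refine norm_sub_le_of_ae hu le_rfl ?_ ht
    filter_upwards [hae] with t ht htpos
    rw [ht htpos]
    exact norm_resolvent_convolution_le hr (fun s hs =>
      (norm_add_le _ _).trans (by gcongr; exact hH s hs)) t
  refine ⟨max B 0 + ‖u 0‖, fun t ht => ?_⟩
  rcases ht.eq_or_lt with rfl | hpos
  · linarith [le_max_right B 0]
  · calc ‖u t‖ = ‖(u t - u 0) + u 0‖ := by rw [sub_add_cancel]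
      _ ≤ ‖u t - u 0‖ + ‖u 0‖ := norm_add_le _ _
      _ ≤ _ := by gcongr; exact (hB t hpos).trans (le_max_left _ _)

theorem tendsto_zero_of_hasCaputoDerivAt (hα0 : 0 < α) (hα1 : α < 1) (hl : l ∈ stableSector α)
    (hu : ContinuousOn u (Ici 0)) (hh : BddCont h) (hlim : Tendsto h atTop (𝓝 0))
    (heq : ∀ t : ℝ, 0 < t → HasCaputoDerivAt 0 α u (l * u t + h t) t) :
    Tendsto u atTop (𝓝 0) := by
  obtain ⟨r, hr, hint, hae⟩ := exists_kernel_representation hα0 hα1 hl hu hh.1 heq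
  obtain ⟨H, hH⟩ := hh.2
  have hconv := tendsto_resolvent_convolution hr (f := fun t => h t + l * u 0)
    (F := H + ‖l * u 0‖) (c := l * u 0) (hh.1.add continuousOn_const)
    (fun s hs => (norm_add_le _ _).trans (by gcongr; exact hH s hs))
    (by simpa using hlim.add_const (l * u 0))
  -- The limit of `u - u 0` is exactly `-u 0`, so the initial value drops out.
  have hc : (∫ s in Ioi 0, r s) * (l * u 0) = -u 0 := by
    rw [hint]
    have := hl.1
    field_simp
  rw [hc] at hconv
  rw [Metric.tendsto_atTop] at hconv ⊢
  intro ε hε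
  obtain ⟨a, ha⟩ := hconv (ε / 2) (by positivity)
  refine ⟨max a 0 + 1, fun t ht => ?_⟩
  rw [dist_zero_right]
  have := norm_sub_le_of_ae hu (le_max_right a 0) (c := 0) (B := ε / 2) ?_
    (show max a 0 < t by linarith)
  · rw [sub_zero] at this; linarith
  · filter_upwards [hae] with s hs hsa
    have h1 := ha s ((le_max_left a 0).trans hsa.le)
    rw [← hs ((le_max_right a 0).trans_lt hsa), dist_eq_norm] at h1
    rw [sub_zero]
    have e : u s - u 0 - -u 0 = u s := by ring
    rw [e] at h1
    exact h1.le

end Scalar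

/-! ### Back substitution through the Jordan block -/

theorem jordanBlock_mulVec {d : ℕ} (l : ℂ) (x : Fin d → ℂ) (i : Fin d) :
    (jordanBlock d l).mulVec x i
      = l * x i + if h : (i : ℕ) + 1 < d then x ⟨i + 1, h⟩ else 0 := by
  have e : ∀ j : Fin d, jordanBlock d l i j * x j
      = (if i = j then l * x j else 0) + if (i : ℕ) + 1 = j then x j else 0 := by
    intro j
    simp only [jordanBlock, Matrix.of_apply]
    by_cases h1 : i = j
    · subst h1; simp
    · simp [h1]
  rw [Matrix.mulVec, dotProduct]
  simp_rw [e]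
  rw [Finset.sum_add_distrib]
  simp only [Finset.sum_ite_eq, Finset.mem_univ, if_true]
  congr 1
  split_ifs with h
  · rw [Finset.sum_eq_single ⟨i + 1, h⟩ (fun j _ hj => if_neg fun h' => hj (Fin.ext h'.symm))
      (by simp)]
    simp
  · exact Finset.sum_eq_zero fun j _ => if_neg fun h' => h (by rw [h']; exact j.2)

section Jordan

variable {α : ℝ} {d : ℕ} {l : ℂ} {g x : ℝ → Fin d → ℂ}

/-- The forcing of row `i`: the next component of the solution plus `g`. -/
noncomputable def rowForcing (g x : ℝ → Fin d → ℂ) (i : Fin d) (t : ℝ) : ℂ :=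
  (if h : (i : ℕ) + 1 < d then x t ⟨i + 1, h⟩ else 0) + g t i

theorem IsSolution.hasCaputoDerivAt_row (hx : IsSolution α (jordanBlock d l) g x) (i : Fin d)
    (t : ℝ) (ht : 0 < t) :
    HasCaputoDerivAt 0 α (fun s => x s i) (l * x t i + rowForcing g x i t) t := by
  have := hx.2 t ht i
  rwa [jordanBlock_mulVec, add_assoc] at this

theorem IsSolution.continuousOn_row (hx : IsSolution α (jordanBlock d l) g x) (i : Fin d) :
    ContinuousOn (fun t => x t i) (Ici 0) :=
  continuousOn_pi.1 hx.1 i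

/-- Induction on `k` reaches the last `k` rows: `k = 0` is vacuous, and each further row is forced
by one already known to be bounded. Taking `k = d` covers all rows. -/
theorem IsSolution.bddCont_row (hα0 : 0 < α) (hα1 : α < 1) (hl : l ∈ stableSector α)
    (hg : BddCont g) (hx : IsSolution α (jordanBlock d l) g x) :
    ∀ (k : ℕ) (i : Fin d), d ≤ i + k →
      BddCont (rowForcing g x i) ∧ BddCont fun t => x t i := by
  intro k
  induction k with
  | zero => intro i hi; exact absurd i.2 (by omega)
  | succ k ih =>
    intro i hi
    obtain ⟨G, hG⟩ := hg.2
    have hgi : ContinuousOn (fun t => g t i) (Ici 0) := continuousOn_pi.1 hg.1 i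
    have hG' : ∀ t, 0 ≤ t → ‖g t i‖ ≤ G := fun t ht => (norm_le_pi_norm _ i).trans (hG t ht)
    have hf : BddCont (rowForcing g x i) := by
      by_cases h : (i : ℕ) + 1 < d
      · obtain ⟨hc, M, hM⟩ := (ih ⟨i + 1, h⟩ (by simp only; omega)).2
        have e : rowForcing g x i = fun t => x t ⟨i + 1, h⟩ + g t i := by
          funext t; simp [rowForcing, h]
        rw [e]
        exact ⟨hc.add hgi, M + G, fun t ht =>
          (norm_add_le _ _).trans (add_le_add (hM t ht) (hG' t ht))⟩
      · have e : rowForcing g x i = fun t => g t i := by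
          funext t; simp [rowForcing, h]
        rw [e]
        exact ⟨hgi, G, hG'⟩
    exact ⟨hf, hx.continuousOn_row i, bounded_of_hasCaputoDerivAt hα0 hα1 hl
      (hx.continuousOn_row i) hf (hx.hasCaputoDerivAt_row i)⟩

theorem IsSolution.tendsto_row (hα0 : 0 < α) (hα1 : α < 1) (hl : l ∈ stableSector α)
    (hg : BddContDecay g) (hx : IsSolution α (jordanBlock d l) g x) :
    ∀ (k : ℕ) (i : Fin d), d ≤ i + k → Tendsto (fun t => x t i) atTop (𝓝 0) := by
  intro k
  induction k with
  | zero => intro i hi; exact absurd i.2 (by omega)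
  | succ k ih =>
    intro i hi
    have hgi : Tendsto (fun t => g t i) atTop (𝓝 0) :=
      squeeze_zero_norm (fun t => norm_le_pi_norm _ i) hg.2
    refine tendsto_zero_of_hasCaputoDerivAt hα0 hα1 hl (hx.continuousOn_row i)
      (hx.bddCont_row hα0 hα1 hl hg.1 (k + 1) i hi).1 ?_ (hx.hasCaputoDerivAt_row i)
    by_cases h : (i : ℕ) + 1 < d
    · have e : rowForcing g x i = fun t => x t ⟨i + 1, h⟩ + g t i := by
        funext t; simp [rowForcing, h]
      rw [e]
      simpa using (ih ⟨i + 1, h⟩ (by simp only; omega)).add hgi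
    · have e : rowForcing g x i = fun t => g t i := by
        funext t; simp [rowForcing, h]
      rwa [e]

end Jordan

end FracJordan

theorem proposition3 (α : ℝ) (hα0 : 0 < α) (hα1 : α < 1) (d : ℕ) (l : ℂ)
    (hl : l ∈ FracJordan.stableSector α) (g : ℝ → Fin d → ℂ) (hg : FracJordan.BddCont g) :
    (∀ x : ℝ → Fin d → ℂ, FracJordan.IsSolution α (FracJordan.jordanBlock d l) g x →
      ∃ M : ℝ, ∀ t : ℝ, 0 ≤ t → ‖x t‖ ≤ M) ∧
    (FracJordan.BddContDecay g →
      ∀ x : ℝ → Fin d → ℂ, FracJordan.IsSolution α (FracJordan.jordanBlock d l) g x →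
        Tendsto x atTop (𝓝 0)) := by
  refine ⟨fun x hx => ?_, fun hg' x hx => ?_⟩
  · choose M hM using fun i : Fin d =>
      (hx.bddCont_row hα0 hα1 hl hg d i (Nat.le_add_left _ _)).2.2
    refine ⟨∑ i, |M i|, fun t ht => ?_⟩
    refine (pi_norm_le_iff_of_nonneg (Finset.sum_nonneg fun i _ => abs_nonneg _)).2 fun i => ?_
    exact ((hM i t ht).trans (le_abs_self _)).trans
      (Finset.single_le_sum (f := fun i => |M i|) (fun i _ => abs_nonneg _) (Finset.mem_univ i))
  · exact tendsto_pi_nhds.2 fun i =>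
      hx.tendsto_row hα0 hα1 hl hg' d i (Nat.le_add_left _ _)
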